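/- Let $k$ and $N$ be positive integers with $k$ odd and $4\mid N$, and let $\chi$ be a Dirichlet character modulo $N$. For $\gamma=\begin{pmatrix}a&b\\c&d\end{pmatrix}\in\Gamma_0(N)$ put $j(\gamma,z)=\left(\frac{c}{d}\right)\varepsilon_d^{-1}\sqrt{cz+d}$, with Shimura's extended quadratic residue symbol, $\varepsilon_d=1$ or $i$ according as $d\equiv 1$ or $3 \pmod 4$, and the principal square root. Let $M_{k/2}(N,\chi)$ be the space of holomorphic functions $f$ on the upper half-plane $\mathbb H$ with $f(\gamma z)=\chi(d)\,j(\gamma,z)^k f(z)$ for all $\gamma\in\Gamma_0(N)$ that are holomorphic at all cusps. Let $G$ be the group of pairs $(\alpha,\phi)$ with $\alpha=\begin{pmatrix}a&b\\c&d\end{pmatrix}\in \mathrm{GL}_2^+(\mathbb Q)$ and $\phi$ holomorphic on $\mathbb H$ with $\phi(z)^2=t\,(cz+d)/\sqrt{\det\alpha}$ for some $t\in\{\pm1\}$, with the law $(\alpha,\phi(z))(\beta,\psi(z))=(\alpha\beta,\phi(\beta z)\psi(z))$, acting on functions by $(f|[(\alpha,\phi)]_{k/2})(z)=f(\alpha z)\phi(z)^{-k}$.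 Let $\Delta_0(N)=\{(\gamma,j(\gamma,z)):\gamma\in\Gamma_0(N)\}$, a subgroup of $G$. For a positive integer $n$ let $\xi=\left(\begin{pmatrix}1&0\\0&n^2\end{pmatrix},n^{1/2}\right)$, and define the Hecke operator $T_{n^2}$ on $M_{k/2}(N,\chi)$ by $$T_{n^2}f=n^{\frac k2-2}\sum_\nu\chi(a_\nu)\,f|[\xi_\nu]_{k/2},\qquad \Delta_0(N)\,\xi\,\Delta_0(N)=\bigsqcup_\nu\Delta_0(N)\,\xi_\nu,$$ where $a_\nu$ is the upper left entry of the matrix of $\xi_\nu$. **Theorem.** Let $p$ be a prime and let $\ell\ge 2$ be an integer. If $p\mid N$, then, as operators on $M_{k/2}(N,\chi)$, $$T_{p^{2\ell}}=(T_{p^2})^{\ell}.$$ If $p\nmid N$, then, as operators on $M_{k/2}(N,\chi)$, $$T_{p^{2\ell+2}}=T_{p^2}\,T_{p^{2\ell}}-\chi(p^2)\,p^{k-2}\,T_{p^{2\ell-2}}.$$ -/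

import Mathlib

open scoped MatrixGroups Manifold UpperHalfPlane
open UpperHalfPlane

noncomputable section

namespace HalfIntegral

/-- A rational invertible matrix, viewed as a real one (so that it acts on `ℍ`). -/
abbrev toReal : GL (Fin 2) ℚ →* GL (Fin 2) ℝ :=
  Matrix.GeneralLinearGroup.map (algebraMap ℚ ℝ)

/-- The group of pairs `(α, φ)` with `α ∈ GL₂⁺(ℚ)` and `φ` a holomorphic function on `ℍ` such that
`φ(z)² = t (c z + d) / √(det α)` for some `t ∈ {1, -1}`, where `(c, d)` is the bottom row of `α`. -/
@[ext]
structure MetaGroup where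
  mat : GL (Fin 2) ℚ
  phi : ℍ → ℂ
  det_pos : 0 < mat.det.val
  holo : MDifferentiable 𝓘(ℂ) 𝓘(ℂ) phi
  sq : ∃ t : ℂ, (t = 1 ∨ t = -1) ∧ ∀ z : ℍ,
    phi z ^ 2 = t * (((mat 1 0 : ℚ) : ℂ) * (z : ℂ) + ((mat 1 1 : ℚ) : ℂ)) /
      ((Real.sqrt ((mat.det.val : ℚ) : ℝ) : ℝ) : ℂ)

lemma toReal_det_pos {α : GL (Fin 2) ℚ} (h : 0 < α.det.val) : 0 < (toReal α).det.val := by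
  have : (toReal α).det.val = ((α.det.val : ℚ) : ℝ) := by
    simp [Matrix.det_fin_two]
  rw [this]; exact_mod_cast h

lemma denom_toReal (α : GL (Fin 2) ℚ) (z : ℂ) :
    denom (toReal α) z = ((α 1 0 : ℚ) : ℂ) * z + ((α 1 1 : ℚ) : ℂ) := by
  simp [denom]

lemma denom_toReal_mul {α β : GL (Fin 2) ℚ} (hβ : 0 < β.det.val) (z : ℍ) :
    denom (toReal (α * β)) z =
      denom (toReal α) ((toReal β • z : ℍ) : ℂ) * denom (toReal β) z := by
  rw [map_mul, denom_cocycle_σ, σ, if_pos (toReal_det_pos hβ)]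
  rfl

namespace MetaGroup

lemma sq_denom (x : MetaGroup) : ∃ t : ℂ, (t = 1 ∨ t = -1) ∧ ∀ z : ℍ,
    x.phi z ^ 2 = t * denom (toReal x.mat) z /
      ((Real.sqrt ((x.mat.det.val : ℚ) : ℝ) : ℝ) : ℂ) := by
  simpa only [denom_toReal] using x.sq

lemma sqrt_ne_zero {q : ℚ} (h : 0 < q) : ((Real.sqrt ((q : ℚ) : ℝ) : ℝ) : ℂ) ≠ 0 := by
  have : (0 : ℝ) < q := by exact_mod_cast h
  exact_mod_cast (Real.sqrt_pos.mpr this).ne'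

lemma phi_ne_zero (x : MetaGroup) (z : ℍ) : x.phi z ≠ 0 := by
  obtain ⟨t, ht, h⟩ := x.sq_denom
  intro h0
  have h1 := h z
  rw [h0] at h1
  have ht0 : t ≠ 0 := by rcases ht with rfl | rfl <;> norm_num
  have := div_ne_zero (mul_ne_zero ht0 (denom_ne_zero (toReal x.mat) z)) (sqrt_ne_zero x.det_pos)
  apply this
  rw [← h1]; norm_num

/-- `(α, φ) (β, ψ) = (α β, φ(β z) ψ(z))`. -/
instance : Mul MetaGroup where
  mul x y :=
    { mat := x.mat * y.mat
      phi := fun z ↦ x.phi (toReal y.mat • z) * y.phi z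
      det_pos := by
        rw [map_mul, Units.val_mul]; exact mul_pos x.det_pos y.det_pos
      holo := (x.holo.comp (mdifferentiable_smul (toReal_det_pos y.det_pos))).mul y.holo
      sq := by
        obtain ⟨t, ht, h⟩ := x.sq_denom
        obtain ⟨s, hs, h'⟩ := y.sq_denom
        refine ⟨t * s, ?_, fun z ↦ ?_⟩
        · rcases ht with rfl | rfl <;> rcases hs with rfl | rfl <;> norm_num
        · have hx : (0 : ℝ) ≤ (x.mat.det.val : ℚ) := by exact_mod_cast x.det_pos.le
          rw [← denom_toReal, denom_toReal_mul y.det_pos, mul_pow, h, h', map_mul, Units.val_mul,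
            Rat.cast_mul, Real.sqrt_mul hx, Complex.ofReal_mul]
          have a1 := sqrt_ne_zero x.det_pos
          have a2 := sqrt_ne_zero y.det_pos
          field_simp }

instance : One MetaGroup where
  one :=
    { mat := 1
      phi := fun _ ↦ 1
      det_pos := by simp
      holo := mdifferentiable_const
      sq := ⟨1, Or.inl rfl, fun z ↦ by simp⟩ }

instance : Inv MetaGroup where
  inv x :=
    { mat := x.mat⁻¹
      phi := fun z ↦ (x.phi (toReal x.mat⁻¹ • z))⁻¹
      det_pos := by
        rw [map_inv, Units.val_inv_eq_inv_val]; exact inv_pos.mpr x.det_pos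
      holo := by
        have hd : 0 < (x.mat⁻¹).det.val := by
          rw [map_inv, Units.val_inv_eq_inv_val]; exact inv_pos.mpr x.det_pos
        have h := x.holo.comp (mdifferentiable_smul (toReal_det_pos hd))
        intro z
        have h2 : DifferentiableAt ℂ (fun w : ℂ ↦ w⁻¹) (x.phi (toReal x.mat⁻¹ • z)) :=
          differentiableAt_inv (x.phi_ne_zero _)
        exact h2.mdifferentiableAt.comp z (h z)
      sq := by
        have hd : 0 < (x.mat⁻¹).det.val := by
          rw [map_inv, Units.val_inv_eq_inv_val]; exact inv_pos.mpr x.det_pos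
        obtain ⟨t, ht, h⟩ := x.sq_denom
        refine ⟨t, ht, fun z ↦ ?_⟩
        have hc := denom_toReal_mul (α := x.mat) hd z
        have hdet : (x.mat⁻¹).det.val = (x.mat.det.val)⁻¹ := by
          rw [map_inv, Units.val_inv_eq_inv_val]
        rw [mul_inv_cancel, map_one, denom_one] at hc
        have a3 := eq_inv_of_mul_eq_one_right hc.symm
        have a4 : t⁻¹ = t := by rcases ht with rfl | rfl <;> norm_num
        rw [← denom_toReal, inv_pow, h, hdet, Rat.cast_inv, Real.sqrt_inv, Complex.ofReal_inv, a3,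
          inv_div, div_eq_mul_inv, mul_inv, a4, div_eq_mul_inv, inv_inv]
        ring }

@[simp] lemma mul_mat (x y : MetaGroup) : (x * y).mat = x.mat * y.mat := rfl
@[simp] lemma mul_phi (x y : MetaGroup) (z : ℍ) :
    (x * y).phi z = x.phi (toReal y.mat • z) * y.phi z := rfl
@[simp] lemma one_mat : (1 : MetaGroup).mat = 1 := rfl
@[simp] lemma one_phi (z : ℍ) : (1 : MetaGroup).phi z = 1 := rfl
@[simp] lemma inv_mat (x : MetaGroup) : (x⁻¹).mat = x.mat⁻¹ := rfl
@[simp] lemma inv_phi (x : MetaGroup) (z : ℍ) :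
    (x⁻¹).phi z = (x.phi (toReal x.mat⁻¹ • z))⁻¹ := rfl

instance : Group MetaGroup :=
  Group.ofLeftAxioms
    (fun x y z ↦ by
      ext1
      · simp [mul_assoc]
      · funext w; simp [mul_assoc, mul_smul])
    (fun x ↦ by
      ext1
      · simp
      · funext w; simp)
    (fun x ↦ by
      ext1
      · simp
      · funext w
        simp only [mul_phi, inv_phi, one_phi, ← mul_smul, ← map_mul, inv_mul_cancel, map_one,
          one_smul]
        exact inv_mul_cancel₀ (x.phi_ne_zero w))

/-- The projection onto the matrix. -/
def proj : MetaGroup →* GL (Fin 2) ℚ where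
  toFun := mat
  map_one' := rfl
  map_mul' _ _ := rfl

end MetaGroup

/-- The weight `k/2` action `(f | [(α, φ)])(z) = f(α z) φ(z)⁻ᵏ`. -/
def slash (k : ℕ) (f : ℍ → ℂ) (x : MetaGroup) : ℍ → ℂ :=
  fun z ↦ f (toReal x.mat • z) * (x.phi z ^ k)⁻¹

lemma slash_mul (k : ℕ) (f : ℍ → ℂ) (x y : MetaGroup) :
    slash k f (x * y) = slash k (slash k f x) y := by
  funext z
  simp only [slash, MetaGroup.mul_mat, MetaGroup.mul_phi, map_mul, mul_smul, mul_pow, mul_inv]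
  ring

lemma slash_one (k : ℕ) (f : ℍ → ℂ) : slash k f 1 = f := by
  funext z; simp [slash]

/-- The quadratic residue symbol `(c / d)` for odd `d`, extended to negative `d`: it is the Jacobi
symbol `(c / |d|)`, with an extra sign when both `c` and `d` are negative (so `(0 / ±1) = 1`). -/
def quadSymbol (c d : ℤ) : ℤ :=
  if c < 0 ∧ d < 0 then -jacobiSym c d.natAbs else jacobiSym c d.natAbs

/-- `ε_d`, for odd `d`: `1` if `d ≡ 1 mod 4` and `i` if `d ≡ 3 mod 4`. -/
def eps (d : ℤ) : ℂ := if d % 4 = 1 then 1 else Complex.I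

/-- The automorphy factor `j(γ, z) = (c / d) ε_d⁻¹ √(c z + d)`, with the principal branch of the
square root (argument in `(-π/2, π/2]`). -/
def autFactor (γ : SL(2, ℤ)) (z : ℍ) : ℂ :=
  (quadSymbol (γ 1 0) (γ 1 1) : ℂ) * (eps (γ 1 1))⁻¹ *
    (((γ 1 0 : ℤ) : ℂ) * (z : ℂ) + ((γ 1 1 : ℤ) : ℂ)) ^ (1 / 2 : ℂ)

lemma toReal_mapGL_smul (γ : SL(2, ℤ)) (z : ℍ) :
    toReal (Matrix.SpecialLinearGroup.mapGL ℚ γ) • z = γ • z := by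
  rw [toReal, Matrix.SpecialLinearGroup.map_mapGL]
  rfl

lemma isCoprime_bottom (γ : SL(2, ℤ)) : IsCoprime (γ 1 0) (γ 1 1) := by
  have h := γ.det_coe
  rw [Matrix.det_fin_two] at h
  exact ⟨-(γ 0 1), γ 0 0, by linarith⟩

lemma quadSymbol_sq (γ : SL(2, ℤ)) : ((quadSymbol (γ 1 0) (γ 1 1) : ℤ) : ℂ) ^ 2 = 1 := by
  have h : (jacobiSym (γ 1 0) (γ 1 1).natAbs) ^ 2 = 1 := by
    apply jacobiSym.sq_one
    have := Int.isCoprime_iff_gcd_eq_one.mp (isCoprime_bottom γ)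
    rw [Int.gcd_eq_natAbs] at this ⊢
    rwa [Int.natAbs_natCast]
  have h2 : quadSymbol (γ 1 0) (γ 1 1) ^ 2 = 1 := by
    unfold quadSymbol
    split_ifs <;> simpa using h
  exact_mod_cast h2

lemma eps_inv_sq (d : ℤ) : (eps d)⁻¹ ^ 2 = 1 ∨ (eps d)⁻¹ ^ 2 = -1 := by
  unfold eps
  split_ifs <;> simp

lemma mdifferentiable_sqrt (γ : SL(2, ℤ)) :
    MDifferentiable 𝓘(ℂ) 𝓘(ℂ) (fun z : ℍ ↦
      (((γ 1 0 : ℤ) : ℂ) * (z : ℂ) + ((γ 1 1 : ℤ) : ℂ)) ^ (1 / 2 : ℂ)) := by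
  by_cases hc : γ 1 0 = 0
  · simp only [hc, Int.cast_zero, zero_mul, zero_add]
    exact mdifferentiable_const
  · intro z
    have h1 : DifferentiableAt ℂ
        (fun w : ℂ ↦ (((γ 1 0 : ℤ) : ℂ) * w + ((γ 1 1 : ℤ) : ℂ)) ^ (1 / 2 : ℂ)) (z : ℂ) := by
      apply DifferentiableAt.cpow_const (by fun_prop)
      right
      have : (((γ 1 0 : ℤ) : ℂ) * (z : ℂ) + ((γ 1 1 : ℤ) : ℂ)).im = (γ 1 0 : ℝ) * z.im := by simp
      rw [this]
      exact mul_ne_zero (by exact_mod_cast hc) z.im_ne_zero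
    exact h1.mdifferentiableAt.comp z (mdifferentiable_coe z)

/-- The lift `(γ, j(γ, z))` of `γ`; it is only used for `γ ∈ Γ₀(N)` with `4 ∣ N`. -/
def lift (γ : SL(2, ℤ)) : MetaGroup where
  mat := Matrix.SpecialLinearGroup.mapGL ℚ γ
  phi := autFactor γ
  det_pos := by simp
  holo := mdifferentiable_const.mul (mdifferentiable_sqrt γ)
  sq := by
    refine ⟨(eps (γ 1 1))⁻¹ ^ 2, eps_inv_sq _, fun z ↦ ?_⟩
    have : ∀ w : ℂ, (w ^ (1 / 2 : ℂ)) ^ 2 = w := fun w ↦ by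
      rw [one_div]; exact Complex.cpow_nat_inv_pow w two_ne_zero
    rw [autFactor, mul_pow, mul_pow, quadSymbol_sq, this]
    simp

/-- `Δ₀(N)`, for `4 ∣ N`: the group of the lifts `(γ, j(γ, z))`, `γ ∈ Γ₀(N)`. (As `4 ∣ N`, the
factor `j` is a cocycle on `Γ₀(N)`, so the lifts already form a group.) -/
def Delta0 (N : ℕ) : Subgroup MetaGroup :=
  Subgroup.closure (lift '' (CongruenceSubgroup.Gamma0 N : Set SL(2, ℤ)))

/-- The space `M_{k/2}(N, χ)`: holomorphic functions on `ℍ` with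
`f(γ z) = χ(d) j(γ, z)ᵏ f(z)` for `γ ∈ Γ₀(N)` with lower right entry `d`, that is
`f | [(γ, j(γ, ·))] = χ(d) f`, and holomorphic at all cusps, that is such that every translate of
`f` under the group of pairs `(α, φ)` is bounded as `Im z → ∞`. -/
def modForms (k N : ℕ) (χ : DirichletCharacter ℂ N) : Submodule ℂ (ℍ → ℂ) where
  carrier := {f | MDifferentiable 𝓘(ℂ) 𝓘(ℂ) f ∧
    (∀ γ ∈ CongruenceSubgroup.Gamma0 N, ∀ z : ℍ,
      f (γ • z) = χ ((γ 1 1 : ℤ) : ZMod N) * autFactor γ z ^ k * f z) ∧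
    ∀ x : MetaGroup, IsBoundedAtImInfty (slash k f x)}
  add_mem' := by
    rintro f g ⟨hf1, hf2, hf3⟩ ⟨hg1, hg2, hg3⟩
    refine ⟨hf1.add hg1, fun γ hγ z ↦ ?_, fun x ↦ ?_⟩
    · simp only [Pi.add_apply, hf2 γ hγ, hg2 γ hγ]; ring
    · have : slash k (f + g) x = slash k f x + slash k g x := by
        funext z; simp [slash, add_mul]
      rw [this]; exact (hf3 x).add (hg3 x)
  zero_mem' := by
    refine ⟨mdifferentiable_const, fun γ hγ z ↦ by simp, fun x ↦ ?_⟩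
    have : slash k (0 : ℍ → ℂ) x = 0 := by funext z; simp [slash]
    rw [this]; exact zero_form_isBoundedAtImInfty
  smul_mem' := by
    rintro c f ⟨hf1, hf2, hf3⟩
    refine ⟨hf1.const_smul c, fun γ hγ z ↦ ?_, fun x ↦ ?_⟩
    · simp only [Pi.smul_apply, smul_eq_mul, hf2 γ hγ]; ring
    · have : slash k (c • f) x = c • slash k f x := by
        funext z; simp [slash, mul_assoc]
      rw [this]; exact (hf3 x).const_smul_left c

/-- The element `([1, 0; 0, n²], n^{1/2})`. -/
def xi (n : ℕ) [NeZero n] : MetaGroup where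
  mat := Matrix.GeneralLinearGroup.mkOfDetNeZero !![1, 0; 0, (n : ℚ) ^ 2]
    (by simp [NeZero.ne n])
  phi := fun _ ↦ ((Real.sqrt n : ℝ) : ℂ)
  det_pos := by
    have : (0 : ℚ) < n := by exact_mod_cast Nat.pos_of_ne_zero (NeZero.ne n)
    have h2 : (0 : ℚ) < (n : ℚ) ^ 2 := pow_pos this 2
    simpa [Matrix.GeneralLinearGroup.mkOfDetNeZero] using h2
  holo := mdifferentiable_const
  sq := by
    refine ⟨1, Or.inl rfl, fun z ↦ ?_⟩
    have hn : (n : ℂ) ≠ 0 := by exact_mod_cast NeZero.ne n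
    have h1 : (((Real.sqrt n : ℝ) : ℂ)) ^ 2 = n := by
      rw [← Complex.ofReal_pow, Real.sq_sqrt (Nat.cast_nonneg n)]; simp
    rw [h1]
    simp [Matrix.GeneralLinearGroup.mkOfDetNeZero, Real.sqrt_sq]
    field_simp

/-- The double coset `Δ₀(N) ξ Δ₀(N)` of `ξ = ([1, 0; 0, n²], n^{1/2})`. -/
def heckeCoset (N n : ℕ) [NeZero n] : Set MetaGroup :=
  DoubleCoset.doubleCoset (xi n) (Delta0 N) (Delta0 N)

/-- Two elements of `Δ₀(N) ξ Δ₀(N)` are equivalent if they lie in the same coset `Δ₀(N) η`. -/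
def cosetSetoid (N n : ℕ) [NeZero n] : Setoid (heckeCoset N n) :=
  (QuotientGroup.rightRel (Delta0 N)).comap Subtype.val

/-- The set `Δ₀(N) \ Δ₀(N) ξ Δ₀(N)` of the cosets `Δ₀(N) η` contained in `Δ₀(N) ξ Δ₀(N)`. -/
def CosetSpace (N n : ℕ) [NeZero n] : Type :=
  Quotient (cosetSetoid N n)

/-- The summand `χ(a) f | [η]`, where `a` is the upper left entry of the matrix of `η` (an integer
for `η ∈ Δ₀(N) ξ Δ₀(N)`). -/
def summand (k : ℕ) {N : ℕ} (χ : DirichletCharacter ℂ N) (f : ℍ → ℂ) (η : MetaGroup) : ℍ → ℂ :=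
  χ (((η.mat 0 0 : ℚ).num : ℤ) : ZMod N) • slash k f η

lemma slash_smul (k : ℕ) (c : ℂ) (f : ℍ → ℂ) (x : MetaGroup) :
    slash k (c • f) x = c • slash k f x := by
  funext z; simp [slash, mul_assoc]

lemma slash_add (k : ℕ) (f g : ℍ → ℂ) (x : MetaGroup) :
    slash k (f + g) x = slash k f x + slash k g x := by
  funext z; simp [slash, add_mul]

lemma slash_sum (k : ℕ) {ι : Type*} (s : Finset ι) (f : ι → ℍ → ℂ) (x : MetaGroup) :
    slash k (∑ i ∈ s, f i) x = ∑ i ∈ s, slash k (f i) x := by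
  funext z; simp [slash, Finset.sum_mul]

lemma autFactor_ne_zero (γ : SL(2, ℤ)) (z : ℍ) : autFactor γ z ≠ 0 :=
  (lift γ).phi_ne_zero z

lemma gamma0_unit {N : ℕ} {γ : SL(2, ℤ)} (hγ : γ ∈ CongruenceSubgroup.Gamma0 N) :
    ((γ 0 0 : ℤ) : ZMod N) * ((γ 1 1 : ℤ) : ZMod N) = 1 := by
  have h := γ.det_coe
  rw [Matrix.det_fin_two] at h
  have h2 := congrArg (fun t : ℤ ↦ (t : ZMod N)) h
  rw [CongruenceSubgroup.Gamma0_mem] at hγ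
  simpa [hγ] using h2

lemma mem_modForms_slash_lift {k N : ℕ} {χ : DirichletCharacter ℂ N} {f : ℍ → ℂ}
    (hf : f ∈ modForms k N χ) {γ : SL(2, ℤ)} (hγ : γ ∈ CongruenceSubgroup.Gamma0 N) :
    slash k f (lift γ) = χ ((γ 1 1 : ℤ) : ZMod N) • f := by
  funext z
  have h0 : autFactor γ z ^ k ≠ 0 := pow_ne_zero _ (autFactor_ne_zero γ z)
  change f (toReal (Matrix.SpecialLinearGroup.mapGL ℚ γ) • z) * (autFactor γ z ^ k)⁻¹ = _
  rw [toReal_mapGL_smul, hf.2.1 γ hγ]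
  simp only [Pi.smul_apply, smul_eq_mul]
  field_simp

lemma delta0_spec {N : ℕ} {δ : MetaGroup} (hδ : δ ∈ Delta0 N) :
    ∃ γ ∈ CongruenceSubgroup.Gamma0 N, δ.mat = Matrix.SpecialLinearGroup.mapGL ℚ γ ∧
      ∀ (k : ℕ) (χ : DirichletCharacter ℂ N), ∀ f ∈ modForms k N χ,
        slash k f δ = χ ((γ 1 1 : ℤ) : ZMod N) • f := by
  induction hδ using Subgroup.closure_induction with
  | mem x hx =>
    obtain ⟨γ, hγ, rfl⟩ := hx
    exact ⟨γ, hγ, rfl, fun k χ f hf ↦ mem_modForms_slash_lift hf hγ⟩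
  | one => exact ⟨1, one_mem _, by simp, fun k χ f hf ↦ by simp [slash_one]⟩
  | mul x y _ _ hx hy =>
    obtain ⟨γ, hγ, h1, h2⟩ := hx
    obtain ⟨γ', hγ', h1', h2'⟩ := hy
    refine ⟨γ * γ', mul_mem hγ hγ', by simp [h1, h1'], fun k χ f hf ↦ ?_⟩
    rw [slash_mul, h2 k χ f hf, slash_smul, h2' k χ f hf, smul_smul, ← map_mul]
    congr 2
    have h := (CongruenceSubgroup.Gamma0Map N).map_mul ⟨γ, hγ⟩ ⟨γ', hγ'⟩
    exact h.symm
  | inv x _ hx =>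
    obtain ⟨γ, hγ, h1, h2⟩ := hx
    refine ⟨γ⁻¹, inv_mem hγ, by simp [h1], fun k χ f hf ↦ ?_⟩
    have h3 : slash k (slash k f x) x⁻¹ = f := by rw [← slash_mul, mul_inv_cancel, slash_one]
    rw [h2 k χ f hf, slash_smul] at h3
    have h4 : ((γ⁻¹ : SL(2, ℤ)) 1 1 : ℤ) = γ 0 0 := by
      simp [Matrix.SpecialLinearGroup.coe_inv, Matrix.adjugate_fin_two]
    rw [h4]
    nth_rewrite 2 [← h3]
    rw [smul_smul, ← map_mul, gamma0_unit hγ, map_one, one_smul]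

lemma heckeCoset_integral {N n : ℕ} [NeZero n] {x : MetaGroup} (hx : x ∈ heckeCoset N n) :
    ∃ A : Matrix (Fin 2) (Fin 2) ℤ, (x.mat : Matrix (Fin 2) (Fin 2) ℚ) = A.map (Int.cast) ∧
      ((A 1 0 : ℤ) : ZMod N) = 0 := by
  obtain ⟨δ, hδ, δ', hδ', rfl⟩ := DoubleCoset.mem_doubleCoset.mp hx
  obtain ⟨γ, hγ, h1, -⟩ := delta0_spec hδ
  obtain ⟨γ', hγ', h1', -⟩ := delta0_spec hδ'
  refine ⟨(γ : Matrix (Fin 2) (Fin 2) ℤ) * !![1, 0; 0, (n : ℤ) ^ 2] *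
    (γ' : Matrix (Fin 2) (Fin 2) ℤ), ?_, ?_⟩
  · simp only [MetaGroup.mul_mat, h1, h1', Units.val_mul]
    ext i j
    fin_cases i <;> fin_cases j <;>
      simp [xi, Matrix.GeneralLinearGroup.mkOfDetNeZero, Matrix.mul_apply, Fin.sum_univ_two]
  · rw [CongruenceSubgroup.Gamma0_mem] at hγ hγ'
    simp [Matrix.mul_apply, Fin.sum_univ_two, hγ, hγ']

lemma summand_left {k N n : ℕ} [NeZero n] {χ : DirichletCharacter ℂ N} {f : ℍ → ℂ}
    (hf : f ∈ modForms k N χ) {x δ : MetaGroup} (hx : x ∈ heckeCoset N n) (hδ : δ ∈ Delta0 N) :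
    summand k χ f (δ * x) = summand k χ f x := by
  obtain ⟨A, hA, hA0⟩ := heckeCoset_integral hx
  obtain ⟨γ, hγ, h1, h2⟩ := delta0_spec hδ
  have e1 : ((δ * x).mat 0 0 : ℚ) = ((γ 0 0 * A 0 0 + γ 0 1 * A 1 0 : ℤ) : ℚ) := by
    simp [h1, hA, Matrix.mul_apply, Fin.sum_univ_two]
  have e2 : (x.mat 0 0 : ℚ) = ((A 0 0 : ℤ) : ℚ) := by simp [hA]
  simp only [summand, e1, e2, Rat.num_intCast, slash_mul, h2 k χ f hf, slash_smul, smul_smul]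
  rw [← map_mul]
  congr 2
  push_cast
  rw [hA0, mul_zero, add_zero, mul_right_comm, gamma0_unit hγ, one_mul]

lemma summand_right {k N n : ℕ} [NeZero n] {χ : DirichletCharacter ℂ N} (f : ℍ → ℂ)
    {x : MetaGroup} (hx : x ∈ heckeCoset N n) {γ : SL(2, ℤ)}
    (hγ : γ ∈ CongruenceSubgroup.Gamma0 N) :
    summand k χ f (x * lift γ) =
      χ ((γ 0 0 : ℤ) : ZMod N) • slash k (summand k χ f x) (lift γ) := by
  obtain ⟨A, hA, hA0⟩ := heckeCoset_integral hx
  have e1 : ((x * lift γ).mat 0 0 : ℚ) = ((A 0 0 * γ 0 0 + A 0 1 * γ 1 0 : ℤ) : ℚ) := by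
    simp [hA, lift, Matrix.mul_apply, Fin.sum_univ_two]
  have e2 : (x.mat 0 0 : ℚ) = ((A 0 0 : ℤ) : ℚ) := by simp [hA]
  simp only [summand, e1, e2, Rat.num_intCast, slash_mul, slash_smul, smul_smul]
  rw [← map_mul]
  congr 2
  rw [CongruenceSubgroup.Gamma0_mem] at hγ
  push_cast
  rw [hγ, mul_zero, add_zero, mul_comm]

lemma mul_mem_heckeCoset {N n : ℕ} [NeZero n] {x δ : MetaGroup} (hx : x ∈ heckeCoset N n)
    (hδ : δ ∈ Delta0 N) : x * δ ∈ heckeCoset N n := by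
  obtain ⟨a, ha, b, hb, rfl⟩ := DoubleCoset.mem_doubleCoset.mp hx
  exact DoubleCoset.mem_doubleCoset.mpr ⟨a, ha, b * δ, mul_mem hb hδ, by simp [mul_assoc]⟩

/-- Right multiplication by an element of `Δ₀(N)` on the set of cosets. -/
def cosetMulRight (N n : ℕ) [NeZero n] (δ : Delta0 N) : CosetSpace N n ≃ CosetSpace N n where
  toFun := Quotient.map' (fun x ↦ ⟨x.1 * δ.1, mul_mem_heckeCoset x.2 δ.2⟩) (by
    intro x y h
    have h' := QuotientGroup.rightRel_apply.mp h
    refine QuotientGroup.rightRel_apply.mpr ?_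
    simpa [mul_assoc] using h')
  invFun := Quotient.map' (fun x ↦ ⟨x.1 * δ.1⁻¹, mul_mem_heckeCoset x.2 (inv_mem δ.2)⟩) (by
    intro x y h
    have h' := QuotientGroup.rightRel_apply.mp h
    refine QuotientGroup.rightRel_apply.mpr ?_
    simpa [mul_assoc] using h')
  left_inv := by
    rintro ⟨x⟩
    exact congrArg (Quotient.mk (cosetSetoid N n)) (Subtype.ext (by simp))
  right_inv := by
    rintro ⟨x⟩
    exact congrArg (Quotient.mk (cosetSetoid N n)) (Subtype.ext (by simp))

/-- The summand of a coset; it does not depend on the representative. -/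
def cosetSummand {k N : ℕ} {χ : DirichletCharacter ℂ N} (f : modForms k N χ) (n : ℕ) [NeZero n]
    (q : CosetSpace N n) : ℍ → ℂ :=
  Quotient.lift (s := cosetSetoid N n) (fun x ↦ summand k χ f.1 x.1) (by
    intro x y h
    have h' := QuotientGroup.rightRel_apply.mp h
    have := summand_left f.2 x.2 h'
    rw [inv_mul_cancel_right] at this
    exact this.symm) q

lemma finite_central : Finite {x : MetaGroup // x.mat = 1} := by
  have hI : ∀ x : {x : MetaGroup // x.mat = 1}, ∃ t : ℂ, (t = 1 ∨ t = -1) ∧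
      ∀ z : ℍ, x.1.phi z ^ 2 = t := by
    rintro ⟨x, hx⟩
    obtain ⟨t, ht, h⟩ := x.sq_denom
    exact ⟨t, ht, fun z ↦ by simpa [hx] using h z⟩
  have hfin : Finite {c : ℂ | c ^ 4 = 1} := by
    have : {c : ℂ | c ^ 4 = 1} ⊆ ((Polynomial.nthRoots 4 (1 : ℂ)).toFinset : Set ℂ) := by
      intro c hc
      simpa [Polynomial.mem_nthRoots] using hc
    exact (Finset.finite_toSet _).subset this
  refine Finite.of_injective
    (fun x : {x : MetaGroup // x.mat = 1} ↦ (⟨x.1.phi I, ?_⟩ : {c : ℂ | c ^ 4 = 1})) ?_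
  · obtain ⟨t, ht, h⟩ := hI x
    have : x.1.phi I ^ 4 = (x.1.phi I ^ 2) ^ 2 := by ring
    simp only [Set.mem_ofPred_eq, this, h]
    rcases ht with rfl | rfl <;> norm_num
  · intro x y hxy
    have hxy' : x.1.phi I = y.1.phi I := congrArg Subtype.val hxy
    obtain ⟨t, ht, h⟩ := hI x
    obtain ⟨s, hs, h'⟩ := hI y
    have hts : t = s := by rw [← h I, ← h' I, hxy']
    have hE : Set.EqOn x.1.phi y.1.phi Set.univ := by
      refine isPreconnected_univ.eq_of_sq_eq x.1.holo.continuous.continuousOn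
        y.1.holo.continuous.continuousOn (fun z _ ↦ ?_) (fun _ ↦ y.1.phi_ne_zero _)
        (Set.mem_univ I) hxy'
      simp [h, h', hts]
    apply Subtype.ext
    ext1
    · rw [x.2, y.2]
    · funext z; exact hE (Set.mem_univ z)

/-- There are finitely many cosets. -/
instance finite_cosetSpace (N n : ℕ) [NeZero n] : Finite (CosetSpace N n) := by
  have := finite_central
  have : NeZero (n ^ 2) := ⟨pow_ne_zero _ (NeZero.ne n)⟩
  -- every coset has a representative `ξ δ`
  have hrep : ∀ q : CosetSpace N n, ∃ δ : MetaGroup, ∃ hδ : δ ∈ Delta0 N,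
      q = Quotient.mk (cosetSetoid N n) ⟨xi n * δ,
        mul_mem_heckeCoset (DoubleCoset.mem_doubleCoset_self _ _ _) hδ⟩ := by
    rintro ⟨x, hx⟩
    obtain ⟨a, ha, b, hb, rfl⟩ := DoubleCoset.mem_doubleCoset.mp hx
    refine ⟨b, hb, Quotient.sound (QuotientGroup.rightRel_apply.mpr ?_)⟩
    have : xi n * b * (a * xi n * b)⁻¹ = a⁻¹ := by group
    change xi n * b * (a * xi n * b)⁻¹ ∈ Delta0 N
    rw [this]; exact inv_mem ha
  choose d hd hq using hrep
  choose g hg hgm _ using fun q ↦ delta0_spec (hd q)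
  -- two representatives with congruent matrices differ by a central element
  have key : ∀ q q' : CosetSpace N n,
      Matrix.SpecialLinearGroup.map (Int.castRingHom (ZMod (n ^ 2))) (g q) =
        Matrix.SpecialLinearGroup.map (Int.castRingHom (ZMod (n ^ 2))) (g q') →
      ∃ ζ : {x : MetaGroup // x.mat = 1}, ∃ η ∈ Delta0 N,
        xi n * d q = η * ζ.1 * (xi n * d q') := by
    intro q q' h
    set κ : SL(2, ℤ) := g q * (g q')⁻¹ with hκ
    have hκ1 : Matrix.SpecialLinearGroup.map (Int.castRingHom (ZMod (n ^ 2))) κ = 1 := by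
      rw [hκ, map_mul, map_inv, h, mul_inv_cancel]
    have hκ0 : κ ∈ CongruenceSubgroup.Gamma0 N := mul_mem (hg q) (inv_mem (hg q'))
    have hb : ((n ^ 2 : ℕ) : ℤ) ∣ κ 0 1 := by
      rw [← ZMod.intCast_zmod_eq_zero_iff_dvd]
      have := congrArg (fun M : SL(2, ZMod (n ^ 2)) ↦ M 0 1) hκ1
      simpa using this
    obtain ⟨b, hb⟩ := hb
    have hdet := κ.det_coe
    rw [Matrix.det_fin_two] at hdet
    push_cast at hb
    obtain ⟨μ, m00, m01, m10, m11⟩ : ∃ μ : SL(2, ℤ), μ 0 0 = κ 0 0 ∧ μ 0 1 = b ∧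
        μ 1 0 = κ 1 0 * (n : ℤ) ^ 2 ∧ μ 1 1 = κ 1 1 :=
      ⟨⟨!![κ 0 0, b; κ 1 0 * (n : ℤ) ^ 2, κ 1 1], by
        rw [Matrix.det_fin_two_of]; rw [hb] at hdet; linarith⟩, rfl, rfl, rfl, rfl⟩
    have hμ : μ ∈ CongruenceSubgroup.Gamma0 N := by
      rw [CongruenceSubgroup.Gamma0_mem] at hκ0 ⊢
      simp [m10, hκ0]
    have hL : lift μ ∈ Delta0 N := Subgroup.subset_closure ⟨μ, hμ, rfl⟩
    have hmat : (xi n * d q).mat = (lift μ).mat * (xi n * d q').mat := by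
      have e1 : (d q).mat = Matrix.SpecialLinearGroup.mapGL ℚ κ * (d q').mat := by
        rw [hgm, hgm, ← map_mul, hκ, inv_mul_cancel_right]
      have e2 : (xi n).mat * Matrix.SpecialLinearGroup.mapGL ℚ κ = (lift μ).mat * (xi n).mat := by
        ext i j
        fin_cases i <;> fin_cases j <;>
          simp [xi, lift, m00, m01, m10, m11, Matrix.GeneralLinearGroup.mkOfDetNeZero, Matrix.mul_apply,
            Fin.sum_univ_two, hb, mul_comm]
      rw [MetaGroup.mul_mat, MetaGroup.mul_mat, e1, ← mul_assoc, e2, mul_assoc]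
    refine ⟨⟨(lift μ)⁻¹ * (xi n * d q) * (xi n * d q')⁻¹, ?_⟩, lift μ, hL, by group⟩
    rw [MetaGroup.mul_mat, MetaGroup.mul_mat, hmat, MetaGroup.inv_mat, MetaGroup.inv_mat]
    group
  have : Nonempty (CosetSpace N n) := ⟨Quotient.mk (cosetSetoid N n)
    ⟨xi n, DoubleCoset.mem_doubleCoset_self _ _ _⟩⟩
  let r : CosetSpace N n → SL(2, ZMod (n ^ 2)) :=
    fun q ↦ Matrix.SpecialLinearGroup.map (Int.castRingHom (ZMod (n ^ 2))) (g q)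
  have hbase : ∀ q, r q = r (Function.invFun r (r q)) := fun q ↦
    (Function.invFun_eq (f := r) ⟨q, rfl⟩).symm
  choose ζ η hη hz using fun q ↦ key q _ (hbase q)
  refine Finite.of_injective (fun q ↦ (r q, ζ q)) ?_
  intro q q' h
  obtain ⟨h1, h2⟩ := Prod.mk.inj h
  have e := hz q
  have e' := hz q'
  rw [h1, h2] at e
  rw [hq q, hq q']
  refine Quotient.sound (QuotientGroup.rightRel_apply.mpr ?_)
  change xi n * d q' * (xi n * d q)⁻¹ ∈ Delta0 N
  rw [e, e']
  have : η q' * (ζ q').1 * (xi n * d (Function.invFun r (r q'))) *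
      (η q * (ζ q').1 * (xi n * d (Function.invFun r (r q'))))⁻¹ = η q' * (η q)⁻¹ := by group
  rw [this]
  exact mul_mem (hη q') (inv_mem (hη q))

instance fintype_cosetSpace (N n : ℕ) [NeZero n] : Fintype (CosetSpace N n) := Fintype.ofFinite _

lemma mdifferentiable_slash {k : ℕ} {f : ℍ → ℂ} (hf : MDifferentiable 𝓘(ℂ) 𝓘(ℂ) f)
    (x : MetaGroup) : MDifferentiable 𝓘(ℂ) 𝓘(ℂ) (slash k f x) := by
  have h1 := hf.comp (mdifferentiable_smul (toReal_det_pos x.det_pos))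
  have h2 : MDifferentiable 𝓘(ℂ) 𝓘(ℂ) (fun z ↦ (x.phi z ^ k)⁻¹) := by
    intro z
    have h3 : DifferentiableAt ℂ (fun w : ℂ ↦ (w ^ k)⁻¹) (x.phi z) :=
      (differentiableAt_id.pow k).inv (pow_ne_zero _ (x.phi_ne_zero z))
    exact h3.mdifferentiableAt.comp z (x.holo z)
  exact h1.mul h2

/-- `∑_ν χ(a_ν) f | [ξ_ν]`, the sum over the cosets `Δ₀(N) ξ_ν` in `Δ₀(N) ξ Δ₀(N)`. -/
def cosetSum {k N : ℕ} {χ : DirichletCharacter ℂ N} (n : ℕ) [NeZero n] (f : modForms k N χ) :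
    ℍ → ℂ :=
  ∑ q : CosetSpace N n, cosetSummand f n q

lemma cosetSum_mem {k N : ℕ} {χ : DirichletCharacter ℂ N} (n : ℕ) [NeZero n]
    (f : modForms k N χ) : cosetSum n f ∈ modForms k N χ := by
  refine ⟨?_, fun γ hγ z ↦ ?_, fun x ↦ ?_⟩
  · refine Finset.sum_induction _ (fun g : ℍ → ℂ ↦ MDifferentiable 𝓘(ℂ) 𝓘(ℂ) g)
      (fun a b ha hb ↦ ha.add hb) mdifferentiable_const ?_
    rintro ⟨x⟩ -
    exact (mdifferentiable_slash f.2.1 x.1).const_smul _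
  · have hL : lift γ ∈ Delta0 N := Subgroup.subset_closure ⟨γ, hγ, rfl⟩
    have h1 : cosetSum n f = χ ((γ 0 0 : ℤ) : ZMod N) • slash k (cosetSum n f) (lift γ) := by
      conv_lhs => rw [cosetSum, ← Equiv.sum_comp (cosetMulRight N n ⟨lift γ, hL⟩)]
      rw [cosetSum, slash_sum, Finset.smul_sum]
      refine Finset.sum_congr rfl ?_
      rintro ⟨x⟩ -
      exact summand_right f.1 x.2 hγ
    have h2 := congrFun h1 z
    have h0 : autFactor γ z ^ k ≠ 0 := pow_ne_zero _ (autFactor_ne_zero γ z)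
    have h3 : slash k (cosetSum n f) (lift γ) z =
        cosetSum n f (γ • z) * (autFactor γ z ^ k)⁻¹ := by
      rw [← toReal_mapGL_smul]; rfl
    rw [Pi.smul_apply, smul_eq_mul, h3] at h2
    have h4 : χ ((γ 1 1 : ℤ) : ZMod N) * χ ((γ 0 0 : ℤ) : ZMod N) = 1 := by
      rw [← map_mul, mul_comm, gamma0_unit hγ, map_one]
    rw [h2]
    calc cosetSum n f (γ • z)
        = (χ ((γ 1 1 : ℤ) : ZMod N) * χ ((γ 0 0 : ℤ) : ZMod N)) * cosetSum n f (γ • z) := by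
          rw [h4, one_mul]
      _ = _ := by field_simp
  · rw [cosetSum, slash_sum]
    refine Finset.sum_induction _ (fun g : ℍ → ℂ ↦ IsBoundedAtImInfty g)
      (fun a b ha hb ↦ ha.add hb) zero_form_isBoundedAtImInfty ?_
    rintro ⟨y⟩ -
    change IsBoundedAtImInfty (slash k (summand k χ f.1 y.1) x)
    rw [summand, slash_smul, ← slash_mul]
    exact (f.2.2.2 (y.1 * x)).const_smul_left _

/-- The Hecke operator `T_{n²}` on `M_{k/2}(N, χ)`:
`T_{n²} f = n^{k/2 - 2} ∑_ν χ(a_ν) f | [ξ_ν]`, where `Δ₀(N) ξ Δ₀(N)` is the disjoint union of the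
cosets `Δ₀(N) ξ_ν`, with `ξ = ([1, 0; 0, n²], n^{1/2})`, and where `a_ν` is the upper left entry of
the matrix of `ξ_ν`. -/
def heckeTSq (k : ℕ) {N : ℕ} (χ : DirichletCharacter ℂ N) (n : ℕ) [NeZero n] :
    Module.End ℂ (modForms k N χ) where
  toFun f := (((n : ℝ) ^ ((k : ℝ) / 2 - 2) : ℝ) : ℂ) • ⟨cosetSum n f, cosetSum_mem n f⟩
  map_add' f g := by
    rw [← smul_add]
    congr 1
    apply Subtype.ext
    change cosetSum n (f + g) = cosetSum n f + cosetSum n g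
    rw [cosetSum, cosetSum, cosetSum, ← Finset.sum_add_distrib]
    refine Finset.sum_congr rfl ?_
    rintro ⟨x⟩ -
    change summand k χ (f.1 + g.1) x.1 = summand k χ f.1 x.1 + summand k χ g.1 x.1
    rw [summand, slash_add, smul_add]; rfl
  map_smul' c f := by
    rw [RingHom.id_apply, smul_comm]
    congr 1
    apply Subtype.ext
    change cosetSum n (c • f) = c • cosetSum n f
    rw [cosetSum, cosetSum, Finset.smul_sum]
    refine Finset.sum_congr rfl ?_
    rintro ⟨x⟩ -
    change summand k χ (c • f.1) x.1 = c • summand k χ f.1 x.1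
    rw [summand, slash_smul, smul_comm]; rfl

end HalfIntegral

end

noncomputable section

namespace HalfIntegral

/-! ### The theta multiplier system -/

/-! Everything is reduced to a formula for `T_{p^{2l}}` as a weighted sum of translates, after which
the theorem is a computation with sums over residue classes.

First, `j` is a cocycle on `Γ₀(4)` (`lift_mul`), so `Δ₀(N)` consists exactly of the lifts.
Conjugation by `ξ` carries lifts to lifts with no extra sign, because `(n²c/d) = (c/d)`. Hence an
element of the double coset is determined by its matrix (`eq_of_mat_eq`), and finding cosets becomes
a question about integer matrices. For `n = p^l` the representatives are `[p^i, b; 0, p^{2l-i}]`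
with `b` modulo `p^{2l-i}` and `N b` prime to `p^i` (`exists_eq_mul_upperMat`), and their second
components are the explicit constants of `exists_upper_mem_heckeCoset`.

If `p ∣ N`, only `i = 0` survives. Then `T_{p^{2l}} f (z) = p^{-2l} ∑ f((z + b) / p^{2l})`, and
multiplicativity is the splitting of a residue modulo `p^{2l+2}` as `c + p² b`.

If `p ∤ N`, put `X = χ(p) p^{k/2}` and `ψ(b) = ε_p^k (-b/p)`. Then `T_{p^{2l}} f = p^{-2l} ∑ X^i
P_{l,i} f`, where `P_{l,i}` sums `f((p^i z + b) / p^{2l-i})` over `b` with weight `1` for `i = 0,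
2l`, weight `ψ(b)` for odd `i`, and the indicator of `p ∤ b` for the other even `i`. The
compositions `P_{1,j} P_{m+1,i}` follow from two facts: `ψ` has sum zero, and its convolution square
modulo `p` is `p - 1` at `0` and `-1` elsewhere (a Jacobi sum, where `k` odd is used). Two defects
appear. The term `(j, i) = (0, 2)` has coefficient `p² - p` instead of `p²`, and `(2, 0)` produces,
besides `P_{m+2,2}`, the sum of `F((p z + b) / p^{2m+1})`. The term `(1, 1)` supplies exactly the
missing `p` and minus that sum, giving `heckePoly_recursion`. -/

lemma jacobiSym_congr_right {a : ℤ} (h4 : 4 ∣ a) {m n : ℕ} (hm : Odd m) (hn : Odd n)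
    (h : m ≡ n [MOD a.natAbs]) : jacobiSym a m = jacobiSym a n := by
  -- Reciprocity gives `(c/·)` the period `4|c|` on odd numbers; since `(4c/·) = (c/·)` there, this
  -- is the period `|a|` for `a = 4c`.
  obtain ⟨c, rfl⟩ := h4
  have e : ∀ b : ℕ, Odd b → jacobiSym (4 * c) b = jacobiSym c b := fun b hb ↦ by
    rw [← jacobiSym.div_four_left (by lia) (Nat.odd_iff.mp hb)]
    congr 1; lia
  have h' : (4 * c).natAbs = 4 * c.natAbs := by simp [Int.natAbs_mul]
  rw [h'] at h
  rw [e m hm, e n hn, jacobiSym.mod_right c hm, jacobiSym.mod_right c hn, h]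

/-- Since `c ≡ 1` modulo `c - 1`, the symbol `(c/(c-1))` is `1`; and `m (c - 1) ≡ -m ≡ n` modulo
`c`, so periodicity applies. This is the evenness of `(c/·)` for `c > 0`. -/
lemma jacobiSym_reflect {c m n : ℕ} (h4 : 4 ∣ c) (hm : Odd m) (hn : Odd n) (h : m + n = c) :
    jacobiSym c m = jacobiSym c n := by
  have h4' : (4 : ℤ) ∣ (c : ℤ) := by exact_mod_cast h4
  have hc : 0 < c := by have := hm.pos; lia
  have hodd : Odd (c - 1) := by
    obtain ⟨a, rfl⟩ := h4
    exact ⟨2 * a - 1, by lia⟩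
  have hone : jacobiSym c (c - 1) = 1 := by
    rw [jacobiSym.mod_left' (a₂ := 1), jacobiSym.one_left]
    refine Int.ModEq.symm ((Int.modEq_iff_dvd).mpr ⟨1, ?_⟩)
    push_cast [Nat.one_le_iff_ne_zero.mpr hc.ne']
    ring
  have hprod : jacobiSym c (m * (c - 1)) = jacobiSym c n := by
    refine jacobiSym_congr_right h4' (hm.mul hodd) hn ?_
    rw [Int.natAbs_natCast]
    refine (Nat.modEq_iff_dvd).mpr ⟨1 - m, ?_⟩
    have h' : (m : ℤ) + n = c := by exact_mod_cast h
    push_cast [Nat.one_le_iff_ne_zero.mpr hc.ne']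
    linear_combination (1 : ℤ) * h'
  rw [← hprod, jacobiSym.mul_right' _ hm.pos.ne' hodd.pos.ne', hone, mul_one]

/-- The absolute value in the symbol breaks plain periodicity only when `d` and `c + d` lie on
opposite sides of `0`; there `|d| + |c + d| = c` and the reflection applies. -/
lemma quadSymbol_add {c d : ℤ} (hc : 0 < c) (h4 : 4 ∣ c) (hd : Odd d) :
    quadSymbol c (c + d) = quadSymbol c d := by
  have e : ∀ x, quadSymbol c x = jacobiSym c x.natAbs := fun x ↦ by
    rw [quadSymbol, if_neg (by lia)]
  rw [e, e]
  have hcd : Odd (c + d) := by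
    obtain ⟨a, rfl⟩ := h4
    exact (show Even (4 * a) from ⟨2 * a, by ring⟩).add_odd hd
  by_cases h : d < 0 ∧ 0 < c + d
  · lift c to ℕ using hc.le
    have h4' : 4 ∣ c := by exact_mod_cast h4
    exact jacobiSym_reflect h4' (Int.natAbs_odd.mpr hcd) (Int.natAbs_odd.mpr hd) (by lia)
  · refine jacobiSym_congr_right h4 (Int.natAbs_odd.mpr hcd) (Int.natAbs_odd.mpr hd) ?_
    by_cases h0 : d < 0
    · have : d.natAbs = (c + d).natAbs + c.natAbs := by lia
      rw [this]
      exact (Nat.modEq_iff_dvd).mpr ⟨1, by push_cast; ring⟩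
    · have : (c + d).natAbs = d.natAbs + c.natAbs := by lia
      rw [this]
      exact (Nat.modEq_iff_dvd).mpr ⟨-1, by push_cast; ring⟩

/-! ### Principal square roots and the invariance of `j` under `γ ↦ -γ`. -/

lemma sqrt_mul {a b : ℂ} (ha : a ≠ 0) (hb : b ≠ 0)
    (h : a.arg + b.arg ∈ Set.Ioc (-Real.pi) Real.pi) :
    (a * b) ^ (1 / 2 : ℂ) = a ^ (1 / 2 : ℂ) * b ^ (1 / 2 : ℂ) := by
  rw [Complex.cpow_def_of_ne_zero (mul_ne_zero ha hb), Complex.cpow_def_of_ne_zero ha,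
    Complex.cpow_def_of_ne_zero hb, (Complex.log_mul_eq_add_log_iff ha hb).mpr h, ← Complex.exp_add,
    add_mul]

lemma sqrt_neg_one : (-1 : ℂ) ^ (1 / 2 : ℂ) = Complex.I := by
  rw [Complex.cpow_def_of_ne_zero (by norm_num), Complex.log_neg_one]
  rw [show (Real.pi : ℂ) * Complex.I * (1 / 2) = Real.pi / 2 * Complex.I by ring,
    Complex.exp_pi_div_two_mul_I]

lemma sqrt_neg_of_im_neg {w : ℂ} (h : w.im < 0) :
    (-w) ^ (1 / 2 : ℂ) = Complex.I * w ^ (1 / 2 : ℂ) := by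
  have h0 : w ≠ 0 := by rintro rfl; simp at h
  rw [← neg_one_mul, sqrt_mul (by norm_num) h0, sqrt_neg_one]
  have h1 := Complex.arg_neg_iff.mpr h
  have h2 := Complex.neg_pi_lt_arg w
  rw [Complex.arg_neg_one]
  have := Real.pi_pos
  exact ⟨by linarith, by linarith⟩

lemma sqrt_neg_of_im_pos {w : ℂ} (h : 0 < w.im) :
    (-w) ^ (1 / 2 : ℂ) = -Complex.I * w ^ (1 / 2 : ℂ) := by
  have h1 := sqrt_neg_of_im_neg (w := -w) (by simpa using h)
  rw [neg_neg] at h1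
  rw [h1, ← mul_assoc]; simp

lemma autFactor_im (γ : SL(2, ℤ)) (z : ℍ) :
    (((γ 1 0 : ℤ) : ℂ) * (z : ℂ) + ((γ 1 1 : ℤ) : ℂ)).im = (γ 1 0 : ℝ) * z.im := by simp

lemma eps_neg {d : ℤ} (hd : Odd d) : (eps (-d))⁻¹ = (-1) ^ (d / 2) * -Complex.I * (eps d)⁻¹ := by
  rcases (show d % 4 = 1 ∨ d % 4 = 3 by obtain ⟨a, rfl⟩ := hd; lia) with h | h
  · have h1 : (-d) % 4 = 3 := by lia
    have h2 : Even (d / 2) := ⟨d / 4, by lia⟩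
    simp [eps, h, h1, h2.neg_one_zpow]
  · have h1 : (-d) % 4 = 1 := by lia
    have h2 : Odd (d / 2) := ⟨d / 4, by lia⟩
    simp [eps, h, h1, h2.neg_one_zpow]

/-- For odd `d`, `(-1/|d|) = sign(d) (-1)^{(d-1)/2}`, and `d / 2` is the floor `(d - 1)/2`. The sign
convention for two negative entries turns `sign(d)` into `-sign(c)`. -/
lemma quadSymbol_neg_neg {c d : ℤ} (hc : c ≠ 0) (hd : Odd d) :
    (quadSymbol (-c) (-d) : ℂ) = -c.sign * (-1) ^ (d / 2) * quadSymbol c d := by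
  have hodd : Odd d.natAbs := Int.natAbs_odd.mpr hd
  have h0 : d ≠ 0 := by rintro rfl; simp at hd
  have hχ : (((ZMod.χ₄ (d.natAbs : ZMod 4) : ℤ)) : ℂ) = d.sign * (-1) ^ (d / 2) := by
    rcases (show d % 4 = 1 ∨ d % 4 = 3 by obtain ⟨a, rfl⟩ := hd; lia) with h | h
    · have h2 : Even (d / 2) := ⟨d / 4, by lia⟩
      rcases lt_or_gt_of_ne h0 with hn | hn
      · rw [ZMod.χ₄_nat_three_mod_four (by lia), Int.sign_eq_neg_one_of_neg hn, h2.neg_one_zpow]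
        norm_num
      · rw [ZMod.χ₄_nat_one_mod_four (by lia), Int.sign_eq_one_of_pos hn, h2.neg_one_zpow]
        norm_num
    · have h2 : Odd (d / 2) := ⟨d / 4, by lia⟩
      rcases lt_or_gt_of_ne h0 with hn | hn
      · rw [ZMod.χ₄_nat_one_mod_four (by lia), Int.sign_eq_neg_one_of_neg hn, h2.neg_one_zpow]
        norm_num
      · rw [ZMod.χ₄_nat_three_mod_four (by lia), Int.sign_eq_one_of_pos hn, h2.neg_one_zpow]
        norm_num
  unfold quadSymbol
  rw [Int.natAbs_neg, jacobiSym.neg _ hodd]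
  rcases lt_or_gt_of_ne h0 with hn | hn <;> rcases lt_or_gt_of_ne hc with hm | hm
  · rw [if_neg (by lia), if_pos ⟨hm, hn⟩]
    push_cast
    rw [hχ, Int.sign_eq_neg_one_of_neg hn, Int.sign_eq_neg_one_of_neg hm]; push_cast; ring
  · rw [if_neg (by lia), if_neg (by lia)]
    push_cast
    rw [hχ, Int.sign_eq_neg_one_of_neg hn, Int.sign_eq_one_of_pos hm]; push_cast; ring
  · rw [if_neg (by lia), if_neg (by lia)]
    push_cast
    rw [hχ, Int.sign_eq_one_of_pos hn, Int.sign_eq_neg_one_of_neg hm]; push_cast; ring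
  · rw [if_pos (by lia), if_neg (by lia)]
    push_cast
    rw [hχ, Int.sign_eq_one_of_pos hn, Int.sign_eq_one_of_pos hm]; push_cast; ring

lemma bottom_right_of_left_eq_zero {γ : SL(2, ℤ)} (hc : γ 1 0 = 0) :
    (γ 0 0 = 1 ∧ γ 1 1 = 1) ∨ (γ 0 0 = -1 ∧ γ 1 1 = -1) := by
  have h := γ.det_coe
  rw [Matrix.det_fin_two, hc, mul_zero, sub_zero] at h
  exact Int.mul_eq_one_iff_eq_one_or_neg_one.mp h

/-- The changes of the symbol, of `ε_d` and of the square root under `γ ↦ -γ` cancel; the last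
depends on the sign of `c`, as the symbol does. This allows the sign of `c` or of `d` to be chosen
freely when checking the cocycle relation. -/
lemma autFactor_neg {γ : SL(2, ℤ)} (hd : Odd (γ 1 1)) (z : ℍ) :
    autFactor (-γ) z = autFactor γ z := by
  have e0 : (-γ) 1 0 = -γ 1 0 := by simp
  have e1 : (-γ) 1 1 = -γ 1 1 := by simp
  have e2 : ((-γ 1 0 : ℤ) : ℂ) * (z : ℂ) + ((-γ 1 1 : ℤ) : ℂ) =
      -(((γ 1 0 : ℤ) : ℂ) * (z : ℂ) + ((γ 1 1 : ℤ) : ℂ)) := by push_cast; ring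
  unfold autFactor
  rw [e0, e1, e2]
  by_cases hc : γ 1 0 = 0
  · rcases bottom_right_of_left_eq_zero hc with ⟨-, h⟩ | ⟨-, h⟩ <;>
      simp [hc, h, quadSymbol, eps, ← one_div, sqrt_neg_one, -Nat.reduceDiv]
  · have hI : (-1 : ℂ) ^ (γ 1 1 / 2) * (-1) ^ (γ 1 1 / 2) = 1 := by
      rw [← mul_zpow]; simp
    rw [quadSymbol_neg_neg hc hd, eps_neg hd]
    have him := autFactor_im γ z
    rcases lt_or_gt_of_ne hc with hn | hn
    · rw [sqrt_neg_of_im_neg, Int.sign_eq_neg_one_of_neg hn]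
      · linear_combination (↑(quadSymbol (γ 1 0) (γ 1 1)) * (eps (γ 1 1))⁻¹ *
          (((γ 1 0 : ℤ) : ℂ) * (z : ℂ) + ((γ 1 1 : ℤ) : ℂ)) ^ (1 / 2 : ℂ)) *
          (hI - ((-1 : ℂ) ^ (γ 1 1 / 2) * (-1) ^ (γ 1 1 / 2)) * Complex.I_sq)
      · rw [him]; exact mul_neg_of_neg_of_pos (by exact_mod_cast hn) z.im_pos
    · rw [sqrt_neg_of_im_pos, Int.sign_eq_one_of_pos hn]
      · linear_combination (↑(quadSymbol (γ 1 0) (γ 1 1)) * (eps (γ 1 1))⁻¹ *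
          (((γ 1 0 : ℤ) : ℂ) * (z : ℂ) + ((γ 1 1 : ℤ) : ℂ)) ^ (1 / 2 : ℂ)) *
          (hI - ((-1 : ℂ) ^ (γ 1 1 / 2) * (-1) ^ (γ 1 1 / 2)) * Complex.I_sq)
      · rw [him]; exact mul_pos (by exact_mod_cast hn) z.im_pos

lemma odd_bottom_right {γ : SL(2, ℤ)} (h4 : 4 ∣ γ 1 0) : Odd (γ 1 1) := by
  by_contra h
  rw [Int.not_odd_iff_even] at h
  have h2 : (2 : ℤ) ∣ γ 1 0 := Dvd.dvd.trans (by norm_num) h4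
  have := (isCoprime_bottom γ).isUnit_of_dvd' h2 h.two_dvd
  exact absurd (Int.isUnit_iff.mp this) (by norm_num)

lemma sl_mul_apply (a b : SL(2, ℤ)) (i j : Fin 2) :
    (a * b) i j = a i 0 * b 0 j + a i 1 * b 1 j := by
  rw [Matrix.SpecialLinearGroup.coe_mul, Matrix.mul_apply, Fin.sum_univ_two]

/-- The matrix `[1, 0; 4, 1]`. -/
def lowerFour : SL(2, ℤ) := ⟨!![1, 0; 4, 1], by simp [Matrix.det_fin_two_of]⟩

/-- The set of the matrices `g` with `j(γ g, z) = j(γ, g z) j(g, z)` for all `γ ∈ Γ₀(4)`. -/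
def IsCocycleAt (g : SL(2, ℤ)) : Prop :=
  ∀ γ : SL(2, ℤ), 4 ∣ γ 1 0 → lift (γ * g) = lift γ * lift g

lemma lift_eq_mul_iff (γ g : SL(2, ℤ)) : lift (γ * g) = lift γ * lift g ↔
    ∀ z : ℍ, autFactor (γ * g) z = autFactor γ (g • z) * autFactor g z := by
  constructor
  · intro h z
    have := congrFun (congrArg MetaGroup.phi h) z
    rw [MetaGroup.mul_phi] at this
    rw [← toReal_mapGL_smul]
    exact this
  · intro h
    ext1
    · simp [lift]
    · funext z
      rw [MetaGroup.mul_phi]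
      have := h z
      rw [← toReal_mapGL_smul] at this
      exact this

/-! ### The cocycle relation at generators of `Γ₀(4)`. -/

lemma isCocycleAt_neg_one : IsCocycleAt (-1) := by
  intro γ h4
  rw [lift_eq_mul_iff]
  intro z
  have h1 : autFactor (-1) z = 1 := by
    rw [autFactor_neg (by simp)]
    simp [autFactor, quadSymbol, eps]
  rw [mul_neg, mul_one, autFactor_neg (odd_bottom_right h4), h1, mul_one]
  congr 1
  rw [ModularGroup.SL_neg_smul, one_smul]

lemma isCocycleAt_T : IsCocycleAt ModularGroup.T := by
  -- both sides are unchanged when `γ` is replaced by `-γ`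
  suffices H : ∀ γ : SL(2, ℤ), 4 ∣ γ 1 0 → 0 ≤ γ 1 0 → ∀ z : ℍ,
      autFactor (γ * ModularGroup.T) z =
        autFactor γ (ModularGroup.T • z) * autFactor ModularGroup.T z by
    intro γ h4
    rw [lift_eq_mul_iff]
    intro z
    rcases le_total 0 (γ 1 0) with h | h
    · exact H γ h4 h z
    · have h4' : 4 ∣ (-γ) 1 0 := by simpa using h4
      have := H (-γ) h4' (by simpa using h) z
      have h4T : 4 ∣ (γ * ModularGroup.T) 1 0 := by
        rw [sl_mul_apply]; simpa [ModularGroup.T] using h4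
      rwa [neg_mul, autFactor_neg (odd_bottom_right h4), autFactor_neg (odd_bottom_right h4T)]
        at this
  intro γ h4 h z
  have hT : autFactor ModularGroup.T z = 1 := by
    simp [autFactor, quadSymbol, eps, ModularGroup.T]
  have e0 : (γ * ModularGroup.T) 1 0 = γ 1 0 := by
    rw [sl_mul_apply]; simp [ModularGroup.T]
  have e1 : (γ * ModularGroup.T) 1 1 = γ 1 0 + γ 1 1 := by
    rw [sl_mul_apply]; simp [ModularGroup.T]
  have e2 : ((ModularGroup.T • z : ℍ) : ℂ) = z + 1 := by
    simpa using ModularGroup.coe_T_zpow_smul_eq (n := 1) (z := z)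
  rw [hT, mul_one]
  unfold autFactor
  rw [e0, e1, e2]
  have hε : eps (γ 1 0 + γ 1 1) = eps (γ 1 1) := by
    unfold eps
    rw [show (γ 1 0 + γ 1 1) % 4 = γ 1 1 % 4 by lia]
  have hq : quadSymbol (γ 1 0) (γ 1 0 + γ 1 1) = quadSymbol (γ 1 0) (γ 1 1) := by
    rcases h.eq_or_lt with h0 | h0
    · rw [← h0, zero_add]
    · exact quadSymbol_add h0 h4 (odd_bottom_right h4)
  rw [hε, hq]
  congr 2
  push_cast; ring

lemma isCocycleAt_lowerFour : IsCocycleAt lowerFour := by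
  -- both sides are unchanged when `γ` is replaced by `-γ`
  suffices H : ∀ γ : SL(2, ℤ), 4 ∣ γ 1 0 → 0 < γ 1 1 → ∀ z : ℍ,
      autFactor (γ * lowerFour) z = autFactor γ (lowerFour • z) * autFactor lowerFour z by
    intro γ h4
    rw [lift_eq_mul_iff]
    intro z
    rcases lt_trichotomy 0 (γ 1 1) with h | h | h
    · exact H γ h4 h z
    · have := odd_bottom_right h4
      rw [← h] at this
      exact absurd this (by decide)
    · have h4' : 4 ∣ (-γ) 1 0 := by simpa using h4
      have := H (-γ) h4' (by simpa using h) z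
      have h4T : 4 ∣ (γ * lowerFour) 1 0 := by
        rw [sl_mul_apply]; simp [lowerFour]; lia
      rwa [neg_mul, autFactor_neg (odd_bottom_right h4), autFactor_neg (odd_bottom_right h4T)]
        at this
  intro γ h4 h z
  have e0 : (γ * lowerFour) 1 0 = γ 1 0 + 4 * γ 1 1 := by
    rw [sl_mul_apply]; simp [lowerFour]; ring
  have e1 : (γ * lowerFour) 1 1 = γ 1 1 := by
    rw [sl_mul_apply]; simp [lowerFour]
  have hV : autFactor lowerFour z = (4 * (z : ℂ) + 1) ^ (1 / 2 : ℂ) := by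
    simp [autFactor, quadSymbol, eps, lowerFour]
  have him : 0 < (4 * (z : ℂ) + 1).im := by simpa using z.im_pos
  have hw : (4 * (z : ℂ) + 1) ≠ 0 := by
    intro h0; rw [h0] at him; simp at him
  have e2 : ((lowerFour • z : ℍ) : ℂ) = z / (4 * z + 1) := by
    rw [UpperHalfPlane.specialLinearGroup_apply]
    simp [lowerFour]
  set c := γ 1 0 with hc
  set d := γ 1 1 with hd
  set w : ℂ := c * ((lowerFour • z : ℍ) : ℂ) + d with hwdef
  have hprod : ((c + 4 * d : ℤ) : ℂ) * z + d = w * (4 * z + 1) := by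
    rw [hwdef, e2]; push_cast; field_simp; ring
  have hwim : w.im = c * (lowerFour • z : ℍ).im := by simp [hwdef]
  have hpos := (lowerFour • z : ℍ).im_pos
  have hw0 : w ≠ 0 := by
    intro h0
    rw [h0] at hwim
    have hc0 : (c : ℝ) = 0 := by
      rcases mul_eq_zero.mp hwim.symm with h' | h'
      · exact h'
      · exact absurd h' hpos.ne'
    have hc1 : c = 0 := by exact_mod_cast hc0
    rw [hwdef, hc1] at h0
    simp at h0
    lia
  have ha := Complex.arg_le_pi (4 * (z : ℂ) + 1)
  have ha0 : 0 < Complex.arg (4 * (z : ℂ) + 1) := by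
    rcases (Complex.arg_nonneg_iff.mpr him.le).eq_or_lt with h' | h'
    · rw [eq_comm, Complex.arg_eq_zero_iff] at h'
      exact absurd h'.2 him.ne'
    · exact h'
  have ha1 : Complex.arg (4 * (z : ℂ) + 1) < Real.pi :=
    Complex.arg_lt_pi_iff.mpr (Or.inr him.ne')
  -- The two square roots multiply to the principal one if the arguments add up within `(-π, π]`.
  -- For `c ≤ 0` this holds because `arg w ≤ 0`. For `c > 0` a sum beyond `π` would have nonpositive
  -- sine, while the product `(c + 4d) z + d` has positive imaginary part.
  have hmem : w.arg + Complex.arg (4 * (z : ℂ) + 1) ∈ Set.Ioc (-Real.pi) Real.pi := by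
    have hb := Complex.neg_pi_lt_arg w
    have hb' := Complex.arg_le_pi w
    refine ⟨by linarith, ?_⟩
    rcases lt_trichotomy c 0 with hn | hn | hn
    · have : w.im < 0 := by
        rw [hwim]; exact mul_neg_of_neg_of_pos (by exact_mod_cast hn) hpos
      linarith [Complex.arg_neg_iff.mpr this]
    · have : w.arg = 0 := by
        rw [hwdef, hn]
        simp only [Int.cast_zero, zero_mul, zero_add]
        exact Complex.arg_eq_zero_iff.mpr ⟨by simpa using h.le, by simp⟩
      linarith
    · by_contra hlt
      push Not at hlt
      have hs : Real.sin (w.arg + Complex.arg (4 * (z : ℂ) + 1)) ≤ 0 := by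
        have := Real.sin_nonneg_of_nonneg_of_le_pi
          (x := w.arg + Complex.arg (4 * (z : ℂ) + 1) - Real.pi) (by linarith) (by linarith)
        rw [Real.sin_sub_pi] at this
        linarith
      have him2 : 0 < (w * (4 * z + 1)).im := by
        rw [← hprod]
        have : 0 < ((c + 4 * d : ℤ) : ℝ) * z.im :=
          mul_pos (by exact_mod_cast (by lia : 0 < c + 4 * d)) z.im_pos
        simpa using this
      have key : (w * (4 * z + 1)).im = ‖w‖ * ‖4 * (z : ℂ) + 1‖ *
          Real.sin (w.arg + Complex.arg (4 * (z : ℂ) + 1)) := by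
        rw [Real.sin_add, Complex.mul_im, ← Complex.norm_mul_cos_arg w,
          ← Complex.norm_mul_sin_arg w, ← Complex.norm_mul_cos_arg (4 * (z : ℂ) + 1),
          ← Complex.norm_mul_sin_arg (4 * (z : ℂ) + 1)]
        ring
      rw [key] at him2
      exact absurd him2 (not_lt.mpr (mul_nonpos_of_nonneg_of_nonpos (by positivity) hs))
  have hq : quadSymbol (c + 4 * d) d = quadSymbol c d := by
    unfold quadSymbol
    rw [if_neg (by lia), if_neg (by lia)]
    refine jacobiSym.mod_left' ?_
    have hda : ((d.natAbs : ℕ) : ℤ) = d := by lia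
    rw [hda, Int.add_mul_emod_self_right]
  rw [hV]
  unfold autFactor
  rw [e0, e1, ← hc, ← hd, ← hwdef, hprod, hq, sqrt_mul hw0 hw hmem]
  ring

lemma lift_one : lift 1 = 1 := by
  ext1
  · simp [lift]
  · funext z
    simp [lift, autFactor, quadSymbol, eps]

/-- The matrices at which `j` is a cocycle on `Γ₀(4)`, as a subgroup of `Γ₀(4)`. -/
def cocycleSubgroup : Subgroup SL(2, ℤ) where
  carrier := {g | 4 ∣ g 1 0 ∧ IsCocycleAt g}
  one_mem' := ⟨by simp, fun γ _ ↦ by rw [mul_one, lift_one, mul_one]⟩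
  mul_mem' := by
    rintro a b ⟨ha, ha'⟩ ⟨hb, hb'⟩
    refine ⟨?_, fun γ hγ ↦ ?_⟩
    · rw [sl_mul_apply]
      exact dvd_add (ha.mul_right _) (hb.mul_left _)
    · have h : 4 ∣ (γ * a) 1 0 := by
        rw [sl_mul_apply]
        exact dvd_add (hγ.mul_right _) (ha.mul_left _)
      rw [← mul_assoc, hb' _ h, ha' _ hγ, hb' _ ha, mul_assoc]
  inv_mem' := by
    rintro a ⟨ha, ha'⟩
    have hi : 4 ∣ a⁻¹ 1 0 := by
      simpa [Matrix.SpecialLinearGroup.coe_inv, Matrix.adjugate_fin_two] using ha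
    have key : ∀ γ : SL(2, ℤ), 4 ∣ γ 1 0 → lift (γ * a⁻¹) = lift γ * (lift a)⁻¹ := by
      intro γ hγ
      have h : 4 ∣ (γ * a⁻¹) 1 0 := by
        rw [sl_mul_apply]
        exact dvd_add (hγ.mul_right _) (hi.mul_left _)
      rw [eq_mul_inv_iff_mul_eq, ← ha' _ h, inv_mul_cancel_right]
    have h1 := key 1 (by simp)
    rw [one_mul, lift_one, one_mul] at h1
    exact ⟨hi, fun γ hγ ↦ by rw [key γ hγ, h1]⟩

lemma T_mem_cocycleSubgroup : ModularGroup.T ∈ cocycleSubgroup :=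
  ⟨by simp [ModularGroup.T], isCocycleAt_T⟩

lemma lowerFour_mem_cocycleSubgroup : lowerFour ∈ cocycleSubgroup :=
  ⟨by simp [lowerFour], isCocycleAt_lowerFour⟩

lemma neg_one_mem_cocycleSubgroup : -1 ∈ cocycleSubgroup :=
  ⟨by simp, isCocycleAt_neg_one⟩

/-- Euclidean descent on `|c| + |d|`. Since `4 ∣ c` and `d` is odd, `|c| ≠ 2|d|`. If `|c| > 2|d|`,
adding `±4d` to `c` shrinks it; if `|c| < 2|d|`, adding `±c` to `d` shrinks that. The descent ends
at `c = 0`, that is at `±T^n`. -/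
lemma mem_cocycleSubgroup (n : ℕ) : ∀ g : SL(2, ℤ), 4 ∣ g 1 0 →
    (g 1 0).natAbs + (g 1 1).natAbs ≤ n → g ∈ cocycleSubgroup := by
  induction n with
  | zero =>
    intro g h4 hn
    have := (odd_bottom_right h4).natAbs.pos
    lia
  | succ n ih =>
    intro g h4 hn
    by_cases hc : g 1 0 = 0
    · have huni : ∀ g : SL(2, ℤ), g 1 0 = 0 → g 0 0 = 1 → g 1 1 = 1 → g ∈ cocycleSubgroup := by
        intro g h0 h1 h2
        have : g = ModularGroup.T ^ (g 0 1) := by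
          ext i j
          rw [ModularGroup.coe_T_zpow]
          fin_cases i <;> fin_cases j <;> simp [h0, h1, h2]
        rw [this]
        exact zpow_mem T_mem_cocycleSubgroup _
      rcases bottom_right_of_left_eq_zero hc with ⟨h1, h2⟩ | ⟨h1, h2⟩
      · exact huni g hc h1 h2
      · have h := huni (-g) (by simpa using hc) (by simp [h1]) (by simp [h2])
        have := mul_mem neg_one_mem_cocycleSubgroup h
        simpa using this
    · have hodd := odd_bottom_right h4
      have hne : 2 * (g 1 1).natAbs ≠ (g 1 0).natAbs := by
        obtain ⟨a, ha⟩ := hodd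
        lia
      have step : ∀ u ∈ cocycleSubgroup, 4 ∣ (g * u) 1 0 →
          ((g * u) 1 0).natAbs + ((g * u) 1 1).natAbs ≤ n → g ∈ cocycleSubgroup := by
        intro u hu h1 h2
        have := mul_mem (ih _ h1 h2) (inv_mem hu)
        rwa [mul_inv_cancel_right] at this
      have hT := T_mem_cocycleSubgroup
      have hV := lowerFour_mem_cocycleSubgroup
      have hT0 : (g * ModularGroup.T) 1 0 = g 1 0 := by
        rw [sl_mul_apply]; simp [ModularGroup.T]
      have hT1 : (g * ModularGroup.T) 1 1 = g 1 0 + g 1 1 := by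
        rw [sl_mul_apply]; simp [ModularGroup.T]
      have hV0 : (g * lowerFour) 1 0 = g 1 0 + g 1 1 * 4 := by
        rw [sl_mul_apply]; simp [lowerFour]
      have hV1 : (g * lowerFour) 1 1 = g 1 1 := by
        rw [sl_mul_apply]; simp [lowerFour]
      have hT0' : (g * ModularGroup.T⁻¹) 1 0 = g 1 0 := by
        rw [sl_mul_apply, ModularGroup.coe_T_inv]; simp
      have hT1' : (g * ModularGroup.T⁻¹) 1 1 = -g 1 0 + g 1 1 := by
        rw [sl_mul_apply, ModularGroup.coe_T_inv]; simp
      have hV0' : (g * lowerFour⁻¹) 1 0 = g 1 0 - g 1 1 * 4 := by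
        rw [sl_mul_apply, Matrix.SpecialLinearGroup.coe_inv, Matrix.adjugate_fin_two]
        simp [lowerFour]; ring
      have hV1' : (g * lowerFour⁻¹) 1 1 = g 1 1 := by
        rw [sl_mul_apply, Matrix.SpecialLinearGroup.coe_inv, Matrix.adjugate_fin_two]
        simp [lowerFour]
      have hd0 : g 1 1 ≠ 0 := by
        intro h0; rw [h0] at hodd; exact absurd hodd (by decide)
      rcases lt_or_gt_of_ne hne with h | h
      · rcases lt_or_gt_of_ne hd0 with hd | hd <;> rcases lt_or_gt_of_ne hc with hc' | hc'
        · exact step _ (inv_mem hV) (by lia) (by rw [hV0', hV1']; lia)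
        · exact step _ hV (by lia) (by rw [hV0, hV1]; lia)
        · exact step _ hV (by lia) (by rw [hV0, hV1]; lia)
        · exact step _ (inv_mem hV) (by lia) (by rw [hV0', hV1']; lia)
      · rcases lt_or_gt_of_ne hd0 with hd | hd <;> rcases lt_or_gt_of_ne hc with hc' | hc'
        · exact step _ (inv_mem hT) (by lia) (by rw [hT0', hT1']; lia)
        · exact step _ hT (by lia) (by rw [hT0, hT1]; lia)
        · exact step _ hT (by lia) (by rw [hT0, hT1]; lia)
        · exact step _ (inv_mem hT) (by lia) (by rw [hT0', hT1']; lia)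

/-- `j` is a cocycle on `Γ₀(4)`. -/
theorem lift_mul {γ g : SL(2, ℤ)} (hγ : 4 ∣ γ 1 0) (hg : 4 ∣ g 1 0) :
    lift (γ * g) = lift γ * lift g :=
  (mem_cocycleSubgroup _ g hg le_rfl).2 γ hγ

/-! ### The group `Δ₀(N)` as the set of lifts. -/

lemma dvd_of_mem_gamma0 {N : ℕ} {γ : SL(2, ℤ)} (hγ : γ ∈ CongruenceSubgroup.Gamma0 N) :
    (N : ℤ) ∣ γ 1 0 := by
  rwa [CongruenceSubgroup.Gamma0_mem, ZMod.intCast_zmod_eq_zero_iff_dvd] at hγ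

lemma mem_gamma0_of_dvd {N : ℕ} {γ : SL(2, ℤ)} (h : (N : ℤ) ∣ γ 1 0) :
    γ ∈ CongruenceSubgroup.Gamma0 N := by
  rwa [CongruenceSubgroup.Gamma0_mem, ZMod.intCast_zmod_eq_zero_iff_dvd]

lemma lift_mem_Delta0 {N : ℕ} {γ : SL(2, ℤ)} (hγ : γ ∈ CongruenceSubgroup.Gamma0 N) :
    lift γ ∈ Delta0 N := Subgroup.subset_closure ⟨γ, hγ, rfl⟩

lemma four_dvd_of_mem_gamma0 {N : ℕ} (h4 : 4 ∣ N) {γ : SL(2, ℤ)}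
    (hγ : γ ∈ CongruenceSubgroup.Gamma0 N) : 4 ∣ γ 1 0 :=
  (show (4 : ℤ) ∣ N by exact_mod_cast h4).trans (dvd_of_mem_gamma0 hγ)

lemma mem_Delta0_iff {N : ℕ} (h4 : 4 ∣ N) {δ : MetaGroup} :
    δ ∈ Delta0 N ↔ ∃ γ ∈ CongruenceSubgroup.Gamma0 N, δ = lift γ := by
  constructor
  · intro h
    induction h using Subgroup.closure_induction with
    | mem x hx =>
      obtain ⟨γ, hγ, rfl⟩ := hx
      exact ⟨γ, hγ, rfl⟩
    | one => exact ⟨1, one_mem _, lift_one.symm⟩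
    | mul x y _ _ hx hy =>
      obtain ⟨γ, hγ, rfl⟩ := hx
      obtain ⟨g, hg, rfl⟩ := hy
      exact ⟨γ * g, mul_mem hγ hg,
        (lift_mul (four_dvd_of_mem_gamma0 h4 hγ) (four_dvd_of_mem_gamma0 h4 hg)).symm⟩
    | inv x _ hx =>
      obtain ⟨γ, hγ, rfl⟩ := hx
      refine ⟨γ⁻¹, inv_mem hγ, ?_⟩
      have := lift_mul (four_dvd_of_mem_gamma0 h4 (inv_mem hγ)) (four_dvd_of_mem_gamma0 h4 hγ)
      rw [inv_mul_cancel, lift_one] at this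
      exact (eq_inv_of_mul_eq_one_left this.symm).symm
  · rintro ⟨γ, hγ, rfl⟩
    exact lift_mem_Delta0 hγ

/-! ### Coset representatives -/

lemma coe_toReal_smul {α : GL (Fin 2) ℚ} (h : 0 < α.det.val) (z : ℍ) :
    ((toReal α • z : ℍ) : ℂ) =
      (((α 0 0 : ℚ) : ℂ) * z + ((α 0 1 : ℚ) : ℂ)) / (((α 1 0 : ℚ) : ℂ) * z + ((α 1 1 : ℚ) : ℂ)) := by
  rw [UpperHalfPlane.coe_smul_of_det_pos (toReal_det_pos h), denom_toReal]
  simp [num]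

lemma xi_mat_apply (n : ℕ) [NeZero n] :
    ((xi n).mat : Matrix (Fin 2) (Fin 2) ℚ) = !![1, 0; 0, (n : ℚ) ^ 2] := rfl

lemma coe_xi_smul (n : ℕ) [NeZero n] (z : ℍ) :
    ((toReal (xi n).mat • z : ℍ) : ℂ) = z / (n : ℂ) ^ 2 := by
  rw [coe_toReal_smul (xi n).det_pos, xi_mat_apply]
  simp

/-- Conjugation by `ξ` multiplies `c` by the square `n²`, which does not change the symbol as `n` is
prime to `d`, and `n² c (z / n²) + d = c z + d`. So the two sides agree as pairs, not merely up to a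
root of unity. -/
lemma xi_mul_lift {n : ℕ} [NeZero n] {κ μ : SL(2, ℤ)} (h00 : κ 0 0 = μ 0 0)
    (h01 : κ 0 1 = n ^ 2 * μ 0 1) (h10 : μ 1 0 = n ^ 2 * κ 1 0) (h11 : κ 1 1 = μ 1 1) :
    xi n * lift κ = lift μ * xi n := by
  have hn : (n : ℂ) ≠ 0 := by exact_mod_cast NeZero.ne n
  ext1
  · ext i j
    simp only [MetaGroup.mul_mat, Units.val_mul, xi_mat_apply, lift]
    fin_cases i <;> fin_cases j <;>
      simp [Matrix.mul_apply, Fin.sum_univ_two, h00, h01, h10, h11, mul_comm]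
  · funext z
    rw [MetaGroup.mul_phi, MetaGroup.mul_phi]
    change ((Real.sqrt n : ℝ) : ℂ) * autFactor κ z =
      autFactor μ (toReal (xi n).mat • z) * ((Real.sqrt n : ℝ) : ℂ)
    rw [mul_comm]
    congr 1
    unfold autFactor
    rw [coe_xi_smul, h10, ← h11]
    have hcop : IsCoprime (n : ℤ) (κ 1 1) := by
      have := κ.det_coe
      rw [Matrix.det_fin_two, h01] at this
      exact ⟨-(n * μ 0 1 * κ 1 0), κ 0 0, by linear_combination this⟩
    have hq : quadSymbol (n ^ 2 * κ 1 0) (κ 1 1) = quadSymbol (κ 1 0) (κ 1 1) := by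
      have hpos : (0 : ℤ) < n ^ 2 := pow_pos (by exact_mod_cast Nat.pos_of_ne_zero (NeZero.ne n)) 2
      have hJ : jacobiSym (n ^ 2 * κ 1 0) (κ 1 1).natAbs = jacobiSym (κ 1 0) (κ 1 1).natAbs := by
        rw [jacobiSym.mul_left, jacobiSym.sq_one', one_mul]
        have := Int.isCoprime_iff_gcd_eq_one.mp hcop
        rwa [Int.gcd_eq_natAbs] at this ⊢
      have hs : (n : ℤ) ^ 2 * κ 1 0 < 0 ↔ κ 1 0 < 0 := by
        rw [mul_neg_iff]; simp [hpos, hpos.le]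
      unfold quadSymbol
      simp only [hJ, hs]
    rw [hq]
    congr 2
    push_cast
    field_simp

/-- An element of `Δ₀(N) ξ Δ₀(N)` is determined by its matrix. -/
theorem eq_of_mat_eq {N n : ℕ} [NeZero n] (h4 : 4 ∣ N) {x y : MetaGroup}
    (hx : x ∈ heckeCoset N n) (hy : y ∈ heckeCoset N n) (h : x.mat = y.mat) : x = y := by
  obtain ⟨δ1, hδ1, δ2, hδ2, rfl⟩ := DoubleCoset.mem_doubleCoset.mp hx
  obtain ⟨δ3, hδ3, δ4, hδ4, rfl⟩ := DoubleCoset.mem_doubleCoset.mp hy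
  have hμ := mul_mem (inv_mem hδ3) hδ1
  have hκ := mul_mem hδ4 (inv_mem hδ2)
  obtain ⟨μ, hμ0, hμ1⟩ := (mem_Delta0_iff h4).mp hμ
  obtain ⟨κ, hκ0, hκ1⟩ := (mem_Delta0_iff h4).mp hκ
  have hn : (n : ℚ) ^ 2 ≠ 0 := pow_ne_zero _ (by exact_mod_cast NeZero.ne n)
  have hmat : (xi n * (δ4 * δ2⁻¹)).mat = ((δ3⁻¹ * δ1) * xi n).mat := by
    simp only [MetaGroup.mul_mat, MetaGroup.inv_mat] at h ⊢
    rw [← mul_assoc, mul_inv_eq_iff_eq_mul, mul_assoc, mul_assoc, eq_inv_mul_iff_mul_eq,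
      ← mul_assoc, ← mul_assoc, ← h, mul_assoc]
  -- Equality of the matrices reads `ξ κ = μ ξ` with `κ, μ ∈ Γ₀(N)`, which is exactly the shape in
  -- which the lifts intertwine.
  have key : xi n * (δ4 * δ2⁻¹) = (δ3⁻¹ * δ1) * xi n := by
    rw [hμ1, hκ1] at hmat ⊢
    have hm : ∀ i j, ((xi n * lift κ).mat : Matrix (Fin 2) (Fin 2) ℚ) i j =
      ((lift μ * xi n).mat : Matrix (Fin 2) (Fin 2) ℚ) i j := by rw [hmat]; simp
    simp only [MetaGroup.mul_mat, Units.val_mul, xi_mat_apply, lift] at hm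
    have m00 := hm 0 0
    have m01 := hm 0 1
    have m10 := hm 1 0
    have m11 := hm 1 1
    simp [Matrix.mul_apply, Fin.sum_univ_two] at m00 m01 m10 m11
    refine xi_mul_lift (by exact_mod_cast m00) ?_ ?_ ?_
    · rw [mul_comm]; exact_mod_cast m01
    · exact_mod_cast m10.symm
    · rw [mul_comm] at m11
      exact_mod_cast mul_right_cancel₀ hn m11
  calc δ1 * xi n * δ2 = δ3 * ((δ3⁻¹ * δ1) * xi n) * δ2 := by group
    _ = δ3 * xi n * δ4 := by rw [← key]; group

lemma sqrt_natCast (a : ℕ) : (a : ℂ) ^ (1 / 2 : ℂ) = ((Real.sqrt a : ℝ) : ℂ) := by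
  rw [Real.sqrt_eq_rpow, Complex.ofReal_cpow (Nat.cast_nonneg a)]
  simp

/-- The matrix `[a, b; 0, d]`. -/
def upperMat (a b d : ℕ) (ha : a ≠ 0) (hd : d ≠ 0) : GL (Fin 2) ℚ :=
  Matrix.GeneralLinearGroup.mkOfDetNeZero !![(a : ℚ), b; 0, d] (by simp [ha, hd])

lemma upperMat_apply (a b d : ℕ) (ha : a ≠ 0) (hd : d ≠ 0) :
    (upperMat a b d ha hd : Matrix (Fin 2) (Fin 2) ℚ) = !![(a : ℚ), b; 0, d] := rfl

lemma exists_sl {a b c d : ℤ} (h : a * d - b * c = 1) :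
    ∃ γ : SL(2, ℤ), γ 0 0 = a ∧ γ 0 1 = b ∧ γ 1 0 = c ∧ γ 1 1 = d :=
  ⟨⟨!![a, b; c, d], by rw [Matrix.det_fin_two_of, h]⟩, rfl, rfl, rfl, rfl⟩

/-- Explicit elements of `Δ₀(N) ξ Δ₀(N)` with an upper triangular matrix. -/
theorem exists_upper_mem_heckeCoset {N n a b d : ℕ} [NeZero n] (hN : 0 < N) (h4 : 4 ∣ N)
    (ha : a ≠ 0) (hd : d ≠ 0) (hb : 0 < b) (had : a * d = n ^ 2) (hcop : Nat.Coprime (N * b) a) :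
    ∃ ρ ∈ heckeCoset N n, ρ.mat = upperMat a b d ha hd ∧ ∀ z, ρ.phi z =
      ((Real.sqrt n : ℝ) : ℂ) / ((Real.sqrt a : ℝ) : ℂ) * jacobiSym (-b) a * (eps a)⁻¹ := by
  obtain ⟨C, D, hC, hNC, hCD⟩ : ∃ C D : ℤ, 0 < C ∧ (N : ℤ) ∣ C ∧ a * D = 1 + C * b := by
    obtain ⟨u, v, huv⟩ := Nat.isCoprime_iff_coprime.mpr hcop
    -- The Bézout solution is shifted by a multiple of `a` large enough to make `C` positive; then
    -- `D` is positive too, and no sign convention of the symbol intervenes.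
    refine ⟨N * (-u + a * (|u| + 1)), v + N * b * (|u| + 1), ?_, Dvd.intro _ rfl, ?_⟩
    · refine mul_pos (by exact_mod_cast hN) ?_
      have h1 : (1 : ℤ) ≤ a := by exact_mod_cast Nat.one_le_iff_ne_zero.mpr ha
      have h2 := le_abs_self u
      have h3 := abs_nonneg u
      nlinarith
    · push_cast at huv
      linear_combination huv
  have ha' : (0 : ℤ) < a := by exact_mod_cast Nat.pos_of_ne_zero ha
  have hb' : (0 : ℤ) < b := by exact_mod_cast hb
  have hCb : 0 < C * b := mul_pos hC hb'
  have hD : 0 < D := by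
    by_contra hneg
    have := mul_nonpos_of_nonneg_of_nonpos ha'.le (not_lt.mp hneg)
    lia
  have h4C : 4 ∣ C := (show (4 : ℤ) ∣ N by exact_mod_cast h4).trans hNC
  -- The factorization used is `[1, 0; dC, 1] [a, b; 0, d] = [1, 0; 0, n²] [a, b; C, D]`, which
  -- holds since `a d = n²` and `a D = 1 + C b`.
  obtain ⟨γ, g00, g01, g10, g11⟩ := exists_sl (show (a : ℤ) * D - b * C = 1 by
    linear_combination hCD)
  obtain ⟨γ', g00', g01', g10', g11'⟩ := exists_sl (show (1 : ℤ) * 1 - 0 * (d * C) = 1 by ring)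
  have hγ : γ ∈ CongruenceSubgroup.Gamma0 N := mem_gamma0_of_dvd (by rwa [g10])
  have hγ' : γ' ∈ CongruenceSubgroup.Gamma0 N :=
    mem_gamma0_of_dvd (by rw [g10']; exact hNC.mul_left _)
  have hmem : (lift γ')⁻¹ * xi n * lift γ ∈ heckeCoset N n :=
    DoubleCoset.mem_doubleCoset.mpr ⟨_, inv_mem (lift_mem_Delta0 hγ'), _, lift_mem_Delta0 hγ, rfl⟩
  have hmat : ((lift γ')⁻¹ * xi n * lift γ).mat = upperMat a b d ha hd := by
    simp only [MetaGroup.mul_mat, MetaGroup.inv_mat]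
    rw [mul_assoc, inv_mul_eq_iff_eq_mul]
    have hq : (a : ℚ) * D = 1 + C * b := by exact_mod_cast hCD
    have hq' : (a : ℚ) * d = n ^ 2 := by exact_mod_cast had
    ext i j
    simp only [Units.val_mul, xi_mat_apply, upperMat_apply, lift]
    fin_cases i <;> fin_cases j <;>
      simp [Matrix.mul_apply, Fin.sum_univ_two, g00, g01, g10, g11, g00', g01', g10', g11', ← hq']
    · ring
    · linear_combination d * hq
  refine ⟨_, hmem, hmat, fun z ↦ ?_⟩
  set ρ := (lift γ')⁻¹ * xi n * lift γ with hρ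
  have hrel : lift γ' * ρ = xi n * lift γ := by rw [hρ]; group
  have hphi := congrFun (congrArg MetaGroup.phi hrel) z
  rw [MetaGroup.mul_phi, MetaGroup.mul_phi] at hphi
  change autFactor γ' (toReal ρ.mat • z) * ρ.phi z = ((Real.sqrt n : ℝ) : ℂ) * autFactor γ z
    at hphi
  have hd0 : (d : ℂ) ≠ 0 := by exact_mod_cast hd
  have ha0 : (a : ℂ) ≠ 0 := by exact_mod_cast ha
  have hcoe : ((toReal ρ.mat • z : ℍ) : ℂ) = ((a : ℂ) * z + b) / d := by
    rw [coe_toReal_smul ρ.det_pos, hmat, upperMat_apply]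
    simp
  have hCDc : (a : ℂ) * D = 1 + C * b := by exact_mod_cast hCD
  set w : ℂ := C * z + D with hw
  have hw0 : w ≠ 0 := by
    intro h0
    have h1 : w.im = C * z.im := by simp [hw]
    rw [h0] at h1
    have h2 : (0 : ℝ) < C * z.im := mul_pos (by exact_mod_cast hC) z.im_pos
    simp at h1
    rcases h1 with h1 | h1
    · lia
    · exact z.im_ne_zero h1
  -- At `(a z + b)/d` the linear form `d C · + 1` takes the value `a (C z + D)`, so the factor `√(C
  -- z + D)` cancels against that of `γ` and the resulting second component is constant.
  have e1 : autFactor γ' (toReal ρ.mat • z) = ((Real.sqrt a : ℝ) : ℂ) * w ^ (1 / 2 : ℂ) := by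
    unfold autFactor
    rw [hcoe]
    have harg : ((d * C : ℤ) : ℂ) * (((a : ℂ) * z + b) / d) + ((1 : ℤ) : ℂ) = a * w := by
      push_cast
      rw [hw]
      field_simp
      linear_combination -hCDc
    rw [g10', g11', harg, sqrt_mul ha0 hw0, sqrt_natCast]
    · simp [quadSymbol, eps]
    · rw [Complex.natCast_arg, zero_add]
      exact Complex.arg_mem_Ioc w
  have hodd : Odd a := by
    rw [Nat.odd_iff]
    have : Nat.Coprime 2 a := by
      refine Nat.Coprime.coprime_dvd_left ?_ hcop
      exact ((show 2 ∣ 4 by norm_num).trans h4).mul_right b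
    exact Nat.odd_iff.mp (Nat.coprime_two_left.mp this)
  -- From `a D ≡ 1` modulo `C` comes `(C/a)(C/D) = 1`, and from `-b C ≡ 1` modulo `a` comes
  -- `(-b/a)(C/a) = 1`.
  have e2 : (quadSymbol C D : ℂ) = jacobiSym (-b) a := by
    have hDodd : Odd D := g11 ▸ odd_bottom_right (γ := γ) (g10 ▸ h4C)
    have h1 : jacobiSym C (a * D.natAbs) = 1 := by
      rw [jacobiSym_congr_right (n := 1) h4C (hodd.mul (Int.natAbs_odd.mpr hDodd)) odd_one,
        jacobiSym.one_right]
      refine Nat.ModEq.symm ((Nat.modEq_iff_dvd).mpr ⟨b, ?_⟩)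
      rw [Int.natCast_natAbs, abs_of_pos hC]
      push_cast
      rw [abs_of_pos hD]
      linear_combination hCD
    have h2 : jacobiSym (-b) a * jacobiSym C a = 1 := by
      rw [← jacobiSym.mul_left, jacobiSym.mod_left' (a₂ := 1), jacobiSym.one_left]
      exact Int.ModEq.symm ((Int.modEq_iff_dvd).mpr ⟨-D, by linear_combination hCD⟩)
    rw [jacobiSym.mul_right' _ ha (by lia)] at h1
    have h3 : quadSymbol C D = jacobiSym C D.natAbs := by
      rw [quadSymbol, if_neg (by lia)]
    rw [h3]
    have : jacobiSym C D.natAbs = jacobiSym (-b) a := by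
      linear_combination (-jacobiSym C D.natAbs) * h2 + jacobiSym (-b) a * h1
    rw [this]
  have e3 : eps D = eps a := by
    have : (a : ℤ) * D % 4 = 1 := by
      obtain ⟨c, rfl⟩ := h4C
      rw [hCD, mul_assoc]; lia
    have ha4 : (a : ℤ) % 4 = 1 ∨ (a : ℤ) % 4 = 3 := by
      obtain ⟨c, rfl⟩ := hodd; lia
    unfold eps
    congr 1
    rw [Int.mul_emod] at this
    have h5 : 0 ≤ D % 4 ∧ D % 4 < 4 := by lia
    obtain ⟨h6, h7⟩ := h5
    rcases ha4 with h | h <;> rw [h] at this ⊢ <;> generalize D % 4 = r at * <;>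
      interval_cases r <;> simp_all
  have e4 : autFactor γ z = jacobiSym (-b) a * (eps a)⁻¹ * w ^ (1 / 2 : ℂ) := by
    unfold autFactor
    rw [g10, g11, e2, e3]
  rw [e1, e4] at hphi
  have hs : ((Real.sqrt a : ℝ) : ℂ) ≠ 0 := by
    rw [← sqrt_natCast]
    exact (Complex.cpow_ne_zero_iff_of_exponent_ne_zero (by norm_num)).mpr ha0
  have hws : w ^ (1 / 2 : ℂ) ≠ 0 :=
    (Complex.cpow_ne_zero_iff_of_exponent_ne_zero (by norm_num)).mpr hw0
  field_simp
  apply mul_right_cancel₀ hws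
  linear_combination hphi

/-- The matrices in `Δ₀(N) ξ Δ₀(N)`, for `n = pˡ`, up to left multiplication by `Γ₀(N)`. -/
theorem exists_eq_mul_upperMat {N p l : ℕ} [NeZero p] (h4 : 4 ∣ N) (hp : p.Prime)
    {x : MetaGroup} (hx : x ∈ heckeCoset N (p ^ l)) :
    ∃ γ ∈ CongruenceSubgroup.Gamma0 N, ∃ i ≤ 2 * l, ∃ b : ℕ, 0 < b ∧ b ≤ p ^ (2 * l - i) ∧
      Nat.Coprime (N * b) (p ^ i) ∧ x.mat = Matrix.SpecialLinearGroup.mapGL ℚ γ *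
        upperMat (p ^ i) b (p ^ (2 * l - i)) (pow_ne_zero _ hp.ne_zero)
          (pow_ne_zero _ hp.ne_zero) := by
  obtain ⟨δ1, hδ1, δ2, hδ2, rfl⟩ := DoubleCoset.mem_doubleCoset.mp hx
  obtain ⟨γ₁, hγ₁, rfl⟩ := (mem_Delta0_iff h4).mp hδ1
  obtain ⟨κ, hκ, rfl⟩ := (mem_Delta0_iff h4).mp hδ2
  have hpZ : Prime (p : ℤ) := Nat.prime_iff_prime_int.mp hp
  have hp0 : (p : ℤ) ≠ 0 := hpZ.ne_zero
  obtain ⟨a, ha⟩ : ∃ a, a = κ 0 0 := ⟨_, rfl⟩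
  obtain ⟨b, hb⟩ : ∃ b, b = κ 0 1 := ⟨_, rfl⟩
  obtain ⟨c, hc⟩ : ∃ c, c = κ 1 0 := ⟨_, rfl⟩
  obtain ⟨d, hd⟩ : ∃ d, d = κ 1 1 := ⟨_, rfl⟩
  have hdet : a * d - b * c = 1 := by
    have := κ.det_coe
    rwa [Matrix.det_fin_two, ← ha, ← hb, ← hc, ← hd] at this
  have hNc : (N : ℤ) ∣ c := hc ▸ dvd_of_mem_gamma0 hκ
  have hac : IsCoprime a c := ⟨d, -b, by linear_combination hdet⟩
  -- the greatest common divisor of the first column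
  obtain ⟨i, hi, hg⟩ : ∃ i ≤ 2 * l, Int.gcd a ((p : ℤ) ^ (2 * l) * c) = p ^ i := by
    rw [← Nat.dvd_prime_pow hp]
    have h1 : ((Int.gcd a ((p : ℤ) ^ (2 * l) * c) : ℕ) : ℤ) ∣ a := Int.gcd_dvd_left ..
    have h2 : ((Int.gcd a ((p : ℤ) ^ (2 * l) * c) : ℕ) : ℤ) ∣ (p : ℤ) ^ (2 * l) * c :=
      Int.gcd_dvd_right ..
    have h3 := (hac.of_isCoprime_of_dvd_left h1).dvd_of_dvd_mul_right h2
    exact_mod_cast h3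
  obtain ⟨j, hj⟩ := Nat.exists_eq_add_of_le hi
  have hsub : 2 * l - i = j := by lia
  obtain ⟨a', ha'⟩ : (p : ℤ) ^ i ∣ a := by
    have := Int.gcd_dvd_left (a := a) (b := (p : ℤ) ^ (2 * l) * c)
    rw [hg] at this
    exact_mod_cast this
  -- After division by `p^i` the first column is the primitive vector `(a', p^j c)`; `x` and `y`
  -- complete it to a unimodular matrix whose inverse sends the column to `(p^i, 0)`.
  obtain ⟨x, y, hxy⟩ : ∃ x y : ℤ, x * a' + y * (p ^ j * c) = 1 := by
    have := Int.gcd_eq_gcd_ab a ((p : ℤ) ^ (2 * l) * c)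
    rw [hg, hj, pow_add] at this
    push_cast at this
    generalize Int.gcdA a _ = u at this
    generalize Int.gcdB a _ = v at this
    refine ⟨u, v, mul_left_cancel₀ (pow_ne_zero i hp0) ?_⟩
    linear_combination -this - u * ha'
  set B : ℤ := x * b + y * ((p : ℤ) ^ (2 * l) * d) with hB
  have hpj : (0 : ℤ) < (p : ℤ) ^ j := pow_pos (by exact_mod_cast hp.pos) j
  -- The residue of `B` is taken in `1, …, p^j` rather than `0, …, p^j - 1`, because the explicit
  -- representatives need `b > 0`. The quotient `m` is absorbed into `η` as a power of `T`.
  obtain ⟨b', m, hb0, hbj, hBm⟩ : ∃ (b' : ℕ) (m : ℤ), 0 < b' ∧ b' ≤ p ^ j ∧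
      B = b' + p ^ j * m := by
    have h1 := Int.emod_nonneg (B - 1) hpj.ne'
    have h2 := Int.emod_lt_of_pos (B - 1) hpj
    refine ⟨((B - 1) % (p : ℤ) ^ j + 1).toNat, (B - 1) / (p : ℤ) ^ j, by lia, ?_, ?_⟩
    · zify
      rw [Int.toNat_of_nonneg (by lia)]
      lia
    · rw [Int.toNat_of_nonneg (by lia)]
      linear_combination -Int.emod_add_mul_ediv (B - 1) ((p : ℤ) ^ j)
  obtain ⟨η, e00, e01, e10, e11⟩ := exists_sl
    (show a' * (p ^ j * c * m + x) - (a' * m - y) * (p ^ j * c) = 1 by linear_combination hxy)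
  have hη : η ∈ CongruenceSubgroup.Gamma0 N :=
    mem_gamma0_of_dvd (by rw [e10]; exact hNc.mul_left _)
  refine ⟨γ₁ * η, mul_mem hγ₁ hη, i, hi, b', hb0, hsub.symm ▸ hbj, ?_, ?_⟩
  -- For `i > 0`, `p ∣ a`, so `p ∤ c` and hence `p ∤ N`. If `p` divided `b'`, then either `j = 0`
  -- and `b' = 1`, or `p ∣ x b`, which contradicts `hxy` or `hdet`.
  · rcases Nat.eq_zero_or_pos i with h0 | h0
    · rw [h0, pow_zero]; exact Nat.coprime_one_right _
    refine Nat.Coprime.pow_right _ (Nat.coprime_comm.mp ?_)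
    rw [Nat.Prime.coprime_iff_not_dvd hp, hp.dvd_mul]
    have hpa : (p : ℤ) ∣ a := ha' ▸ (dvd_pow_self _ h0.ne').mul_right _
    rintro (h | h)
    · exact hpZ.not_isUnit (hac.isUnit_of_dvd' hpa
        ((show (p : ℤ) ∣ N by exact_mod_cast h).trans hNc))
    · rcases Nat.eq_zero_or_pos j with h1 | h1
      · rw [h1, pow_zero] at hbj
        exact hp.one_lt.not_ge (Nat.le_of_dvd one_pos (by rwa [show b' = 1 by lia] at h))
      · have h2 : (p : ℤ) ∣ p ^ j := dvd_pow_self _ h1.ne'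
        have h3 : (p : ℤ) ∣ B := by
          rw [hBm]
          exact dvd_add (by exact_mod_cast h) (h2.mul_right _)
        have h4 : (p : ℤ) ∣ x * b := by
          rw [hB] at h3
          refine (dvd_add_left ?_).mp h3
          refine Dvd.dvd.mul_left (Dvd.dvd.mul_right (dvd_pow_self _ (by lia)) _) _
        rcases hpZ.dvd_or_dvd h4 with h5 | h5
        · refine hpZ.not_isUnit (isUnit_of_dvd_one ?_)
          rw [← hxy]
          exact dvd_add (h5.mul_right _) ((h2.mul_right _).mul_left _)
        · refine hpZ.not_isUnit (isUnit_of_dvd_one ?_)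
          rw [← hdet]
          exact dvd_sub (hpa.mul_right _) (h5.mul_right _)
  · rw [map_mul, MetaGroup.mul_mat, MetaGroup.mul_mat, mul_assoc, mul_assoc]
    congr 1
    have hQ1 : (a : ℚ) = p ^ i * a' := by exact_mod_cast ha'
    have hQ2 : (x : ℚ) * a' + y * (p ^ j * c) = 1 := by exact_mod_cast hxy
    have hQ3 : (a : ℚ) * d - b * c = 1 := by exact_mod_cast hdet
    have hQ4 : (x : ℚ) * b + y * ((p : ℚ) ^ (2 * l) * d) = b' + p ^ j * m := by
      have := hB.symm.trans hBm
      exact_mod_cast this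
    have hQ5 : (p : ℚ) ^ (l * 2) = p ^ i * p ^ j := by rw [← pow_add, ← hj, mul_comm]
    rw [mul_comm 2 l, hQ5] at hQ4
    ext r s
    simp only [Units.val_mul, xi_mat_apply, upperMat_apply, lift]
    fin_cases r <;> fin_cases s <;>
      simp [Matrix.mul_apply, Fin.sum_univ_two, e00, e01, e10, e11, ← ha, ← hb, ← hc, ← hd, hsub,
        ← pow_mul, hQ5]
    · rw [hQ1]; ring
    · linear_combination -b * hQ2 + y * (p : ℚ) ^ j * (d * hQ1 - hQ3) + a' * hQ4
    · ring
    · linear_combination -(p : ℚ) ^ j * ((p : ℚ) ^ i * d * hQ2 + x * d * hQ1 - x * hQ3) +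
        (p : ℚ) ^ j * c * hQ4

/-- The index set of the cosets in `Δ₀(N) ξ Δ₀(N)`, for `n = pˡ`: the pairs `(i, b)` for which the
matrix `[pⁱ, b; 0, p²ˡ⁻ⁱ]` represents a coset. -/
def cosetIndex (N p l : ℕ) : Finset (Σ _ : ℕ, ℕ) :=
  (Finset.range (2 * l + 1)).sigma fun i ↦
    (Finset.Icc 1 (p ^ (2 * l - i))).filter fun b ↦ Nat.Coprime (N * b) (p ^ i)

lemma mem_cosetIndex {N p l : ℕ} {s : Σ _ : ℕ, ℕ} : s ∈ cosetIndex N p l ↔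
    s.1 ≤ 2 * l ∧ (0 < s.2 ∧ s.2 ≤ p ^ (2 * l - s.1)) ∧ Nat.Coprime (N * s.2) (p ^ s.1) := by
  simp [cosetIndex, Nat.one_le_iff_ne_zero, Nat.pos_iff_ne_zero]

/-- A unimodular matrix relating two upper triangular ones is `±T^m`; positivity of the diagonal
excludes the sign, and `b`, `b'` in one interval of length `p^{2l-i}` force `m = 0`. -/
lemma upperMat_injective {p l : ℕ} (hp : p.Prime) {γ : SL(2, ℤ)} {i i' b b' : ℕ}
    (hb : 0 < b ∧ b ≤ p ^ (2 * l - i)) (hb' : 0 < b' ∧ b' ≤ p ^ (2 * l - i'))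
    (h : upperMat (p ^ i') b' (p ^ (2 * l - i')) (pow_ne_zero _ hp.ne_zero)
        (pow_ne_zero _ hp.ne_zero) =
      Matrix.SpecialLinearGroup.mapGL ℚ γ *
        upperMat (p ^ i) b (p ^ (2 * l - i)) (pow_ne_zero _ hp.ne_zero)
          (pow_ne_zero _ hp.ne_zero)) : i = i' ∧ b = b' := by
  have hm : ∀ r s, (upperMat (p ^ i') b' (p ^ (2 * l - i')) (pow_ne_zero _ hp.ne_zero)
      (pow_ne_zero _ hp.ne_zero) : Matrix (Fin 2) (Fin 2) ℚ) r s =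
      ((Matrix.SpecialLinearGroup.mapGL ℚ γ *
        upperMat (p ^ i) b (p ^ (2 * l - i)) (pow_ne_zero _ hp.ne_zero)
          (pow_ne_zero _ hp.ne_zero) : GL (Fin 2) ℚ) : Matrix (Fin 2) (Fin 2) ℚ) r s := by
    rw [h]; simp
  simp only [Units.val_mul, upperMat_apply] at hm
  have m00 := hm 0 0
  have m01 := hm 0 1
  have m10 := hm 1 0
  simp [Matrix.mul_apply, Fin.sum_univ_two] at m00 m01 m10
  have hc : γ 1 0 = 0 := by
    rcases m10 with h | h
    · exact h
    · exact absurd h.1 hp.ne_zero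
  have hpi : ∀ e, (0 : ℤ) < p ^ e := fun e ↦ pow_pos (by exact_mod_cast hp.pos) e
  have n00 : (p : ℤ) ^ i' = γ 0 0 * p ^ i := by exact_mod_cast m00
  have n01 : (b' : ℤ) = γ 0 0 * b + γ 0 1 * p ^ (2 * l - i) := by exact_mod_cast m01
  rcases bottom_right_of_left_eq_zero hc with ⟨h1, -⟩ | ⟨h1, -⟩
  · rw [h1, one_mul] at n00 n01
    have hii : i = i' := (Nat.pow_right_injective hp.two_le (by exact_mod_cast n00)).symm
    subst hii
    refine ⟨rfl, ?_⟩
    have hM := hpi (2 * l - i)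
    obtain ⟨hb0, hb1⟩ := hb
    obtain ⟨hb0', hb1'⟩ := hb'
    zify at hb1 hb1'
    generalize (p : ℤ) ^ (2 * l - i) = M at *
    have : γ 0 1 = 0 := by
      by_contra hne
      rcases lt_or_gt_of_ne hne with h | h <;> nlinarith
    rw [this] at n01
    lia
  · rw [h1] at n00
    have := hpi i
    have := hpi i'
    lia

/-- The sum over the cosets in `Δ₀(N) ξ Δ₀(N)`, for `n = pˡ`, with explicit representatives. -/
theorem cosetSum_apply {k N p l : ℕ} [NeZero p] {χ : DirichletCharacter ℂ N} (hN : 0 < N)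
    (h4 : 4 ∣ N) (hp : p.Prime) (f : modForms k N χ) (z : ℍ) :
    cosetSum (p ^ l) f z = ∑ s ∈ cosetIndex N p l, χ ((p ^ s.1 : ℕ) : ZMod N) *
      (f.1 (ofComplex (((p : ℂ) ^ s.1 * z + s.2) / (p : ℂ) ^ (2 * l - s.1))) *
        ((((Real.sqrt (p ^ l : ℕ) : ℝ) : ℂ) / ((Real.sqrt (p ^ s.1 : ℕ) : ℝ) : ℂ) *
          jacobiSym (-s.2) (p ^ s.1) * (eps (p ^ s.1 : ℕ))⁻¹) ^ k)⁻¹) := by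
  have hpow : ∀ e, p ^ e ≠ 0 := fun e ↦ pow_ne_zero e hp.ne_zero
  have hex : ∀ s : cosetIndex N p l, ∃ ρ ∈ heckeCoset N (p ^ l),
      ρ.mat = upperMat (p ^ s.1.1) s.1.2 (p ^ (2 * l - s.1.1)) (hpow _) (hpow _) ∧
      ∀ z, ρ.phi z = ((Real.sqrt (p ^ l : ℕ) : ℝ) : ℂ) / ((Real.sqrt (p ^ s.1.1 : ℕ) : ℝ) : ℂ) *
        jacobiSym (-s.1.2) (p ^ s.1.1) * (eps (p ^ s.1.1 : ℕ))⁻¹ := by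
    rintro ⟨⟨i, b⟩, hs⟩
    obtain ⟨hi, hb, hcop⟩ := mem_cosetIndex.mp hs
    exact exists_upper_mem_heckeCoset hN h4 (hpow _) (hpow _) hb.1
      (by rw [← pow_add, ← pow_mul]; congr 1; lia) hcop
  choose ρ hρ hmat hphi using hex
  let F : cosetIndex N p l → CosetSpace N (p ^ l) := fun s ↦
    Quotient.mk (cosetSetoid N (p ^ l)) ⟨ρ s, hρ s⟩
  have hF : Function.Bijective F := by
    constructor
    · intro s t hst
      have h1 := QuotientGroup.rightRel_apply.mp
        (Quotient.exact (s := cosetSetoid N (p ^ l)) (a := ⟨ρ s, hρ s⟩) (b := ⟨ρ t, hρ t⟩) hst)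
      obtain ⟨γ, hγ, h2⟩ := (mem_Delta0_iff h4).mp h1
      have h3 : ρ t = lift γ * ρ s := by rw [← h2]; simp
      have h5 := congrArg MetaGroup.mat h3
      rw [MetaGroup.mul_mat, hmat, hmat] at h5
      obtain ⟨-, hb, -⟩ := mem_cosetIndex.mp s.2
      obtain ⟨-, hb', -⟩ := mem_cosetIndex.mp t.2
      obtain ⟨e1, e2⟩ := upperMat_injective hp hb hb' h5
      exact Subtype.ext (Sigma.ext e1 (heq_of_eq e2))
    · rintro ⟨x, hx⟩
      obtain ⟨γ, hγ, i, hi, b, hb0, hb1, hcop, hx'⟩ := exists_eq_mul_upperMat h4 hp hx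
      let s : cosetIndex N p l := ⟨⟨i, b⟩, mem_cosetIndex.mpr ⟨hi, ⟨hb0, hb1⟩, hcop⟩⟩
      have hmem : lift γ * ρ s ∈ heckeCoset N (p ^ l) := by
        obtain ⟨δ, hδ, δ', hδ', h⟩ := DoubleCoset.mem_doubleCoset.mp (hρ s)
        exact DoubleCoset.mem_doubleCoset.mpr
          ⟨lift γ * δ, mul_mem (lift_mem_Delta0 hγ) hδ, δ', hδ', by rw [h]; group⟩
      -- Here the decomposition of matrices becomes one of pairs, as both sides lie in the double
      -- coset.
      have hxs : x = lift γ * ρ s := eq_of_mat_eq h4 hx hmem (by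
        rw [hx', MetaGroup.mul_mat, hmat]; rfl)
      refine ⟨s, Quotient.sound (QuotientGroup.rightRel_apply.mpr ?_)⟩
      change x * (ρ s)⁻¹ ∈ Delta0 N
      rw [hxs, mul_inv_cancel_right]
      exact lift_mem_Delta0 hγ
  have hsum : cosetSum (p ^ l) f = ∑ s : cosetIndex N p l, cosetSummand f (p ^ l) (F s) :=
    (Equiv.sum_comp (Equiv.ofBijective F hF) _).symm
  rw [hsum, Finset.sum_apply, ← Finset.sum_coe_sort (cosetIndex N p l)]
  refine Finset.sum_congr rfl fun s _ ↦ ?_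
  change χ ((((ρ s).mat 0 0 : ℚ).num : ℤ) : ZMod N) *
    (f.1 (toReal (ρ s).mat • z) * ((ρ s).phi z ^ k)⁻¹) = _
  rw [hphi]
  have h00 : ((ρ s).mat 0 0 : ℚ) = ((p ^ s.1.1 : ℕ) : ℚ) := by rw [hmat, upperMat_apply]; rfl
  have hcoe : ((toReal (ρ s).mat • z : ℍ) : ℂ) =
      ((p : ℂ) ^ s.1.1 * z + s.1.2) / (p : ℂ) ^ (2 * l - s.1.1) := by
    rw [coe_toReal_smul (ρ s).det_pos, hmat, upperMat_apply]
    simp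
  rw [h00, Rat.num_natCast, ← hcoe, ofComplex_apply]
  simp

/-! ### Sums over residue classes -/

open Finset in
lemma sum_range_mul_split {A M : ℕ} (g : ℕ → ℂ) :
    ∑ e ∈ range (A * M), g e = ∑ c ∈ range A, ∑ b ∈ range M, g (c + A * b) := by
  rw [sum_comm]
  induction M with
  | zero => simp
  | succ M ih =>
    rw [mul_add, mul_one, sum_range_add, ih, sum_range_succ]
    congr 1
    exact sum_congr rfl fun c _ ↦ by rw [add_comm]

open Finset in
lemma sum_range_shift {M : ℕ} {g : ℤ → ℂ} (hg : ∀ b, g (b + M) = g b) (c : ℤ) :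
    ∑ b ∈ range M, g (b + c) = ∑ b ∈ range M, g b := by
  have step : ∀ c : ℤ, ∑ b ∈ range M, g (b + (c + 1)) = ∑ b ∈ range M, g (b + c) := by
    intro c
    have h1 := sum_range_succ (fun b : ℕ ↦ g (b + c)) M
    have h2 := sum_range_succ' (fun b : ℕ ↦ g (b + c)) M
    have h3 : g (M + c) = g ((0 : ℕ) + c) := by
      rw [add_comm (M : ℤ), hg]; simp
    rw [h1, h3] at h2
    have h4 := add_right_cancel h2
    rw [h4]
    refine sum_congr rfl fun b _ ↦ ?_
    congr 1; push_cast; ring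
  induction c using Int.induction_on with
  | zero => simp
  | succ n ih => rw [step, ih]
  | pred n ih =>
    rw [← ih, ← step, sub_add_cancel]

open Finset in
-- Moves a translation from the function to its weight, so that in a composition of two sums the
-- summation over the outer class acts on the weight alone.
lemma sum_range_mul_shift {M : ℕ} {u g : ℤ → ℂ} (hu : ∀ b, u (b + M) = u b)
    (hg : ∀ b, g (b + M) = g b) (c : ℤ) :
    ∑ b ∈ range M, u b * g (b + c) = ∑ b ∈ range M, u (b - c) * g b := by
  have := sum_range_shift (M := M) (g := fun b ↦ u (b - c) * g b)
    (fun b ↦ by simp only [hg, ← hu (b - c)]; congr 2; ring) c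
  simpa using this

lemma periodic_mul {M : ℕ} {u : ℤ → ℂ} (hu : ∀ b, u (b + M) = u b) (b c : ℤ) :
    u (b + M * c) = u b := by
  induction c using Int.induction_on with
  | zero => simp
  | succ n ih => rw [mul_add, mul_one, ← add_assoc, hu, ih]
  | pred n ih => rw [← ih, ← hu]; congr 1; ring

lemma periodic_of_dvd {M M' : ℕ} (h : M ∣ M') {u : ℤ → ℂ} (hu : ∀ b, u (b + M) = u b) (b : ℤ) :
    u (b + M') = u b := by
  obtain ⟨c, rfl⟩ := h
  exact_mod_cast periodic_mul hu b c

/-! ### Hecke sums of periodic functions -/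

/-- The weight with which `F((pⁱ z + b) / p²ˡ⁻ⁱ)` enters `T_{p²ˡ} F`. -/
def heckeWeight (p : ℕ) (ψ : ℤ → ℂ) (l i : ℕ) (b : ℤ) : ℂ :=
  if i = 0 ∨ i = 2 * l then 1 else if Odd i then ψ b else if (p : ℤ) ∣ b then 0 else 1

/-- The sum of the `F((pⁱ z + b) / p²ˡ⁻ⁱ)` over `b` mod `p²ˡ⁻ⁱ`, with weights. -/
def heckePart (p : ℕ) (ψ : ℤ → ℂ) (l i : ℕ) (F : ℂ → ℂ) (z : ℂ) : ℂ :=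
  ∑ b ∈ Finset.range (p ^ (2 * l - i)),
    heckeWeight p ψ l i b * F (((p : ℂ) ^ i * z + b) / (p : ℂ) ^ (2 * l - i))

/-- A multiple of the operator `T_{p²ˡ}`, with `X = χ(p) p^{k/2}`. -/
def heckePoly (p : ℕ) (ψ : ℤ → ℂ) (X : ℂ) (l : ℕ) (F : ℂ → ℂ) (z : ℂ) : ℂ :=
  ∑ i ∈ Finset.range (2 * l + 1), X ^ i * heckePart p ψ l i F z

lemma heckeWeight_add {p : ℕ} {ψ : ℤ → ℂ} (hψ : ∀ b, ψ (b + p) = ψ b) (l i : ℕ) (b : ℤ) :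
    heckeWeight p ψ l i (b + p) = heckeWeight p ψ l i b := by
  simp [heckeWeight, hψ]

/-- The index `0` is a true exception when `l ≥ 1`: its weight is `1`, whereas index `2` at level `l
+ 1` carries the indicator of `p ∤ b`. This is the source of the correction terms in the recursion.
-/
lemma heckeWeight_add_two {p : ℕ} {ψ : ℤ → ℂ} (l i : ℕ) (hi : i ≠ 0) (b : ℤ) :
    heckeWeight p ψ (l + 1) (i + 2) b = heckeWeight p ψ l i b := by
  unfold heckeWeight
  have h1 : (i + 2 = 0 ∨ i + 2 = 2 * (l + 1)) ↔ (i = 0 ∨ i = 2 * l) := by lia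
  have h2 : Odd (i + 2) ↔ Odd i := by simp [Nat.odd_add]
  simp only [h1, h2]

lemma heckeWeight_zero {p : ℕ} {ψ : ℤ → ℂ} (l : ℕ) (b : ℤ) : heckeWeight p ψ l 0 b = 1 := by
  simp [heckeWeight]

lemma heckeWeight_one {p : ℕ} {ψ : ℤ → ℂ} (l : ℕ) (b : ℤ) : heckeWeight p ψ l 1 b = ψ b := by
  unfold heckeWeight
  rw [if_neg (by lia), if_pos odd_one]

lemma heckeWeight_two {p : ℕ} {ψ : ℤ → ℂ} {l : ℕ} (hl : 2 ≤ l) (b : ℤ) :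
    heckeWeight p ψ l 2 b = if (p : ℤ) ∣ b then 0 else 1 := by
  unfold heckeWeight
  rw [if_neg (by lia), if_neg (by decide)]

lemma periodic_div {F : ℂ → ℂ} (hF : ∀ w, F (w + 1) = F w) {M : ℕ} (hM : M ≠ 0) (x : ℂ) (b : ℤ) :
    F ((x + ((b + M : ℤ) : ℂ)) / M) = F ((x + (b : ℂ)) / M) := by
  rw [← hF ((x + (b : ℂ)) / M)]
  congr 1
  have : (M : ℂ) ≠ 0 := by exact_mod_cast hM
  push_cast
  field_simp
  ring

open Finset in
lemma sum_range_dvd {p M : ℕ} (hp : 0 < p) (g : ℤ → ℂ) :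
    ∑ b ∈ range (p * M), (if (p : ℤ) ∣ b then g b else 0) = ∑ b ∈ range M, g (p * b) := by
  rw [sum_range_mul_split (fun b : ℕ ↦ if (p : ℤ) ∣ b then g b else 0),
    sum_eq_single_of_mem 0 (by simpa using hp)]
  · refine sum_congr rfl fun b _ ↦ ?_
    rw [if_pos (by simp)]; simp
  · intro c hc hc0
    refine sum_eq_zero fun b _ ↦ ?_
    rw [if_neg]
    push_cast
    rw [Int.dvd_add_left (Dvd.intro _ rfl)]
    intro h
    have := Int.le_of_dvd (by lia) h
    have := mem_range.mp hc
    lia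

open Finset in
lemma sum_not_dvd {p : ℕ} (hp : 0 < p) (e : ℤ) :
    ∑ c ∈ range (p ^ 2), (if (p : ℤ) ∣ e - c then (0 : ℂ) else 1) = (p : ℂ) ^ 2 - p := by
  have hper : ∀ b : ℤ, (if (p : ℤ) ∣ e - (b + (p ^ 2 : ℕ)) then (0 : ℂ) else 1) =
      if (p : ℤ) ∣ e - b then 0 else 1 := by
    intro b
    have : (p : ℤ) ∣ e - (b + (p ^ 2 : ℕ)) ↔ (p : ℤ) ∣ e - b := by
      rw [← sub_sub, dvd_sub_left (by push_cast; exact Dvd.intro_left (p : ℤ) (by ring))]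
    simp only [this]
  have h1 := sum_range_shift (M := p ^ 2) (g := fun c ↦ if (p : ℤ) ∣ e - c then (0 : ℂ) else 1)
    hper e
  have h2 := sum_range_dvd (M := p) hp (fun _ ↦ (1 : ℂ))
  rw [← h1]
  have h3 : ∀ b : ℕ, (if (p : ℤ) ∣ e - (b + e) then (0 : ℂ) else 1) =
      1 - if (p : ℤ) ∣ b then (1 : ℂ) else 0 := by
    intro b
    have : (p : ℤ) ∣ e - (b + e) ↔ (p : ℤ) ∣ b := by
      rw [show e - (b + e) = -(b : ℤ) by ring, dvd_neg]
    simp only [this]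
    split_ifs <;> simp
  simp only [h3]
  rw [sum_sub_distrib, sq p, h2]
  simp [sq]

/-! ### The nine types of compositions of the parts of `T_{p²}` and `T_{p^{2m+2}}`. -/

open Finset in
-- Residues modulo `p^{2l+2}` are uniquely `c + p² b`. For `p ∣ N` this is the whole
-- multiplicativity statement.
lemma heckePart_zero_zero {p : ℕ} {ψ : ℤ → ℂ} (hp : 0 < p) {F : ℂ → ℂ} (l : ℕ) (z : ℂ) :
    heckePart p ψ 1 0 (heckePart p ψ l 0 F) z = heckePart p ψ (l + 1) 0 F z := by
  have hp0 : (p : ℂ) ≠ 0 := by exact_mod_cast hp.ne'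
  unfold heckePart
  simp only [heckeWeight_zero, one_mul, pow_zero]
  rw [show 2 * (l + 1) - 0 = 2 + 2 * l by lia, pow_add, sum_range_mul_split]
  refine sum_congr rfl fun c _ ↦ sum_congr rfl fun b _ ↦ ?_
  congr 1
  push_cast
  simp only [Nat.sub_zero]
  rw [pow_add]
  field_simp
  ring

open Finset in
-- Writing the outer residue as `c + p c₁`, the part `c₁` only translates `b`; after moving it to
-- the weight, the sum of `ψ(b - c₁)` over `c₁` vanishes.
lemma heckePart_zero_one {p : ℕ} {ψ : ℤ → ℂ} (hp : 0 < p) {F : ℂ → ℂ}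
    (hF : ∀ w, F (w + 1) = F w) (hψ : ∀ b, ψ (b + p) = ψ b)
    (hψ0 : ∀ e : ℤ, ∑ h ∈ range p, ψ (e - h) = 0) (m : ℕ) (z : ℂ) :
    heckePart p ψ 1 0 (heckePart p ψ (m + 1) 1 F) z = 0 := by
  have hp0 : (p : ℂ) ≠ 0 := by exact_mod_cast hp.ne'
  unfold heckePart
  simp only [heckeWeight_zero, heckeWeight_one, one_mul, pow_zero, pow_one]
  rw [show 2 * (m + 1) - 1 = 2 * m + 1 by lia, show p ^ (2 * 1 - 0) = p * p by rw [← sq],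
    sum_range_mul_split]
  refine sum_eq_zero fun c _ ↦ ?_
  set g : ℤ → ℂ := fun b ↦ F ((z + c + p * b) / p ^ (2 * m + 2)) with hg
  have hgper : ∀ b, g (b + (p ^ (2 * m + 1) : ℕ)) = g b := by
    intro b
    simp only [hg]
    rw [← hF ((z + c + p * b) / p ^ (2 * m + 2))]
    congr 1
    push_cast
    rw [pow_succ (p : ℂ) (2 * m + 1)]
    field_simp
    ring
  have hψper := periodic_of_dvd (Dvd.intro_left _ (pow_succ p (2 * m)).symm) hψ
  calc _ = ∑ c1 ∈ range p, ∑ b ∈ range (p ^ (2 * m + 1)), ψ b * g (b + c1) := by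
        refine sum_congr rfl fun c1 _ ↦ sum_congr rfl fun b _ ↦ ?_
        congr 2
        push_cast
        rw [pow_succ (p : ℂ) (2 * m + 1)]
        field_simp
        ring
    _ = ∑ c1 ∈ range p, ∑ b ∈ range (p ^ (2 * m + 1)), ψ (b - c1) * g b :=
        sum_congr rfl fun c1 _ ↦ sum_range_mul_shift hψper hgper c1
    _ = 0 := by
        rw [sum_comm]
        refine sum_eq_zero fun b _ ↦ ?_
        rw [← sum_mul, hψ0, zero_mul]

open Finset in
-- For each `b` there are `p² - p` outer residues `c` with `p ∤ b - c`. For `m = 0` the inner weight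
-- would be constant and the factor `p²`, hence the condition `1 ≤ m`.
lemma heckePart_zero_two {p : ℕ} {ψ : ℤ → ℂ} (hp : 0 < p) {F : ℂ → ℂ}
    (hF : ∀ w, F (w + 1) = F w) (m : ℕ) (hm : 1 ≤ m) (z : ℂ) :
    heckePart p ψ 1 0 (heckePart p ψ (m + 1) 2 F) z =
      ((p : ℂ) ^ 2 - p) * heckePart p ψ m 0 F z := by
  have hp0 : (p : ℂ) ≠ 0 := by exact_mod_cast hp.ne'
  unfold heckePart
  simp only [heckeWeight_zero, heckeWeight_two (show 2 ≤ m + 1 by lia), one_mul, pow_zero]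
  rw [show 2 * (m + 1) - 2 = 2 * m by lia, show 2 * 1 - 0 = 2 by lia, Nat.sub_zero]
  set g : ℤ → ℂ := fun b ↦ F ((z + b) / p ^ (2 * m)) with hg
  set u : ℤ → ℂ := fun b ↦ if (p : ℤ) ∣ b then 0 else 1 with hu
  have hgper : ∀ b, g (b + (p ^ (2 * m) : ℕ)) = g b := by
    intro b
    have := periodic_div hF (pow_ne_zero (2 * m) hp.ne') z b
    simpa [hg] using this
  have huper : ∀ b, u (b + (p ^ (2 * m) : ℕ)) = u b :=
    periodic_of_dvd (dvd_pow_self p (by lia)) (fun b ↦ by simp [hu])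
  calc _ = ∑ c ∈ range (p ^ 2), ∑ b ∈ range (p ^ (2 * m)), u b * g (b + c) := by
        refine sum_congr rfl fun c1 _ ↦ sum_congr rfl fun b _ ↦ ?_
        simp only [hu, hg]
        congr 2
        push_cast
        field_simp
        ring
    _ = ∑ c ∈ range (p ^ 2), ∑ b ∈ range (p ^ (2 * m)), u (b - c) * g b :=
        sum_congr rfl fun c1 _ ↦ sum_range_mul_shift huper hgper c1
    _ = _ := by
        rw [sum_comm, mul_sum]
        refine sum_congr rfl fun b _ ↦ ?_
        rw [← sum_mul, sum_not_dvd hp]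
        simp [hg]

open Finset in
-- The outer residue translates `b` by `p^{t+1} c`, a multiple of `p`, which leaves the weight
-- unchanged; so `p²` equal copies arise.
lemma heckePart_zero_add_three {p : ℕ} {ψ : ℤ → ℂ} (hp : 0 < p) {F : ℂ → ℂ}
    (hF : ∀ w, F (w + 1) = F w) (hψ : ∀ b, ψ (b + p) = ψ b)
    (m t : ℕ) (ht : t + 3 ≤ 2 * (m + 1)) (z : ℂ) :
    heckePart p ψ 1 0 (heckePart p ψ (m + 1) (t + 3) F) z =
      (p : ℂ) ^ 2 * heckePart p ψ m (t + 1) F z := by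
  have hp0 : (p : ℂ) ≠ 0 := by exact_mod_cast hp.ne'
  obtain ⟨j, hj⟩ := Nat.exists_eq_add_of_le ht
  unfold heckePart
  simp only [heckeWeight_zero, one_mul, pow_zero]
  rw [show 2 * (m + 1) - (t + 3) = j by lia, show 2 * 1 - 0 = 2 by lia,
    show 2 * m - (t + 1) = j by lia]
  set g : ℤ → ℂ := fun b ↦ F ((p ^ (t + 1) * z + b) / p ^ j) with hg
  have hgper : ∀ b, g (b + (p ^ j : ℕ)) = g b := by
    intro b
    have := periodic_div hF (pow_ne_zero j hp.ne') (p ^ (t + 1) * z) b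
    simpa [hg] using this
  have hw := heckeWeight_add hψ (m + 1) (t + 3)
  have hwper : ∀ b, heckeWeight p ψ (m + 1) (t + 3) (b + (p ^ j : ℕ)) =
      heckeWeight p ψ (m + 1) (t + 3) b := by
    -- For `j = 0` the modulus `1` is not a multiple of `p`, but then the index is the last one and
    -- the weight is constantly `1`.
    rcases Nat.eq_zero_or_pos j with h0 | h0
    · intro b
      simp [heckeWeight, show t + 3 = 2 * (m + 1) by lia]
    · exact periodic_of_dvd (dvd_pow_self p h0.ne') hw
  calc _ = ∑ c ∈ range (p ^ 2), ∑ b ∈ range (p ^ j),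
          heckeWeight p ψ (m + 1) (t + 3) b * g (b + (p ^ (t + 1) * c : ℕ)) := by
        refine sum_congr rfl fun c1 _ ↦ sum_congr rfl fun b _ ↦ ?_
        simp only [hg]
        congr 2
        push_cast
        rw [pow_add, pow_add]
        field_simp
        ring
    _ = ∑ c ∈ range (p ^ 2), ∑ b ∈ range (p ^ j),
          heckeWeight p ψ (m + 1) (t + 3) b * g b := by
        refine sum_congr rfl fun c1 _ ↦ ?_
        rw [sum_range_mul_shift hwper hgper]
        refine sum_congr rfl fun b _ ↦ ?_
        congr 1
        have := periodic_mul hw b (-(p ^ t * c1))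
        rw [← this]
        congr 1; push_cast; ring
    _ = _ := by
        rw [sum_const, card_range, nsmul_eq_mul]
        push_cast
        congr 1
        refine sum_congr rfl fun b _ ↦ ?_
        rw [heckeWeight_add_two m (t + 1) (by lia)]
        simp [hg]

open Finset in
lemma heckePart_one_zero {p : ℕ} {ψ : ℤ → ℂ} (hp : 0 < p) {F : ℂ → ℂ}
    (hψ : ∀ b, ψ (b + p) = ψ b) (l : ℕ) (z : ℂ) :
    heckePart p ψ 1 1 (heckePart p ψ l 0 F) z = heckePart p ψ (l + 1) 1 F z := by
  have hp0 : (p : ℂ) ≠ 0 := by exact_mod_cast hp.ne'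
  unfold heckePart
  simp only [heckeWeight_zero, heckeWeight_one, one_mul, pow_zero, pow_one]
  rw [show 2 * (l + 1) - 1 = 1 + 2 * l by lia, show 2 * 1 - 1 = 1 by lia, Nat.sub_zero, pow_add,
    sum_range_mul_split, pow_one]
  refine sum_congr rfl fun c _ ↦ ?_
  rw [mul_sum]
  refine sum_congr rfl fun b _ ↦ ?_
  congr 1
  · have := periodic_mul hψ c b
    rw [← this]; push_cast; rfl
  · congr 1
    push_cast
    rw [pow_add]
    field_simp
    ring

open Finset in
-- The convolution of `ψ` with itself is `p` on multiples of `p`, minus `1` everywhere. The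
-- multiples of `p` give the level `m` sum; the constant `-1` leaves the full sum at modulus
-- `p^{2m+1}`, to be cancelled by `heckePart_two_zero`.
lemma heckePart_one_one {p : ℕ} {ψ : ℤ → ℂ} (hp : 0 < p) {F : ℂ → ℂ}
    (hF : ∀ w, F (w + 1) = F w) (hψ : ∀ b, ψ (b + p) = ψ b)
    (hψJ : ∀ e : ℤ, ∑ h ∈ range p, ψ h * ψ (e - h) = if (p : ℤ) ∣ e then (p : ℂ) - 1 else -1)
    (m : ℕ) (z : ℂ) :
    heckePart p ψ 1 1 (heckePart p ψ (m + 1) 1 F) z = p * heckePart p ψ m 0 F z -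
      ∑ b ∈ range (p ^ (2 * m + 1)), F ((p * z + b) / p ^ (2 * m + 1)) := by
  have hp0 : (p : ℂ) ≠ 0 := by exact_mod_cast hp.ne'
  unfold heckePart
  simp only [heckeWeight_zero, heckeWeight_one, one_mul, pow_zero, pow_one]
  rw [show 2 * (m + 1) - 1 = 2 * m + 1 by lia, show 2 * 1 - 1 = 1 by lia, Nat.sub_zero, pow_one]
  set g : ℤ → ℂ := fun b ↦ F ((p * z + b) / p ^ (2 * m + 1)) with hg
  have hgper : ∀ b, g (b + (p ^ (2 * m + 1) : ℕ)) = g b := by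
    intro b
    have := periodic_div hF (pow_ne_zero (2 * m + 1) hp.ne') (p * z) b
    simpa [hg] using this
  have hψper := periodic_of_dvd (Dvd.intro_left _ (pow_succ p (2 * m)).symm) hψ
  calc _ = ∑ h ∈ range p, ψ h * ∑ b ∈ range (p ^ (2 * m + 1)), ψ b * g (b + h) := by
        refine sum_congr rfl fun h _ ↦ ?_
        congr 1
        refine sum_congr rfl fun b _ ↦ ?_
        simp only [hg]
        congr 2
        push_cast
        field_simp
        ring
    _ = ∑ h ∈ range p, ∑ b ∈ range (p ^ (2 * m + 1)), (ψ h * ψ (b - h)) * g b := by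
        refine sum_congr rfl fun h _ ↦ ?_
        rw [sum_range_mul_shift hψper hgper, mul_sum]
        simp only [mul_assoc]
    _ = ∑ b ∈ range (p ^ (2 * m + 1)), (p * (if (p : ℤ) ∣ b then g b else 0) - g b) := by
        rw [sum_comm]
        refine sum_congr rfl fun b _ ↦ ?_
        rw [← sum_mul, hψJ]
        split_ifs <;> ring
    _ = _ := by
        rw [sum_sub_distrib, ← mul_sum, pow_succ' p, sum_range_dvd hp]
        congr 2
        refine sum_congr rfl fun b _ ↦ ?_
        simp only [hg]
        congr 1
        push_cast
        rw [pow_succ]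
        field_simp

open Finset in
-- The translation by `p^{t+1} h` does not affect the weight, so the outer sum of `ψ(h)` factors out
-- and vanishes.
lemma heckePart_one_add_two {p : ℕ} {ψ : ℤ → ℂ} (hp : 0 < p) {F : ℂ → ℂ}
    (hF : ∀ w, F (w + 1) = F w) (hψ : ∀ b, ψ (b + p) = ψ b)
    (hψ0 : ∀ e : ℤ, ∑ h ∈ range p, ψ (e - h) = 0)
    (m t : ℕ) (ht : t + 2 ≤ 2 * (m + 1)) (z : ℂ) :
    heckePart p ψ 1 1 (heckePart p ψ (m + 1) (t + 2) F) z = 0 := by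
  have hp0 : (p : ℂ) ≠ 0 := by exact_mod_cast hp.ne'
  obtain ⟨j, hj⟩ := Nat.exists_eq_add_of_le ht
  unfold heckePart
  simp only [heckeWeight_one, pow_one]
  rw [show 2 * (m + 1) - (t + 2) = j by lia, show 2 * 1 - 1 = 1 by lia, pow_one]
  set g : ℤ → ℂ := fun b ↦ F ((p ^ (t + 2) * z + b) / p ^ j) with hg
  have hgper : ∀ b, g (b + (p ^ j : ℕ)) = g b := by
    intro b
    have := periodic_div hF (pow_ne_zero j hp.ne') (p ^ (t + 2) * z) b
    simpa [hg] using this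
  have hw := heckeWeight_add hψ (m + 1) (t + 2)
  have hwper : ∀ b, heckeWeight p ψ (m + 1) (t + 2) (b + (p ^ j : ℕ)) =
      heckeWeight p ψ (m + 1) (t + 2) b := by
    rcases Nat.eq_zero_or_pos j with h0 | h0
    · intro b
      simp [heckeWeight, show t + 2 = 2 * (m + 1) by lia]
    · exact periodic_of_dvd (dvd_pow_self p h0.ne') hw
  calc _ = ∑ h ∈ range p, ψ h * ∑ b ∈ range (p ^ j),
          heckeWeight p ψ (m + 1) (t + 2) b * g (b + (p ^ (t + 1) * h : ℕ)) := by
        refine sum_congr rfl fun h _ ↦ ?_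
        congr 1
        refine sum_congr rfl fun b _ ↦ ?_
        simp only [hg]
        congr 2
        push_cast
        rw [pow_add, pow_add]
        field_simp
        ring
    _ = ∑ h ∈ range p, ψ h * ∑ b ∈ range (p ^ j),
          heckeWeight p ψ (m + 1) (t + 2) b * g b := by
        refine sum_congr rfl fun h _ ↦ ?_
        rw [sum_range_mul_shift hwper hgper]
        congr 1
        refine sum_congr rfl fun b _ ↦ ?_
        congr 1
        have := periodic_mul hw b (-(p ^ t * h))
        rw [← this]
        congr 1; push_cast; ring
    _ = 0 := by
        have h0 : ∑ h ∈ range p, ψ h = 0 := by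
          have h1 := sum_range_reflect (fun h : ℕ ↦ ψ h) p
          rw [← h1, ← hψ0 (p - 1)]
          refine sum_congr rfl fun h hh ↦ ?_
          have := mem_range.mp hh
          congr 1
          lia
        rw [← sum_mul, h0, zero_mul]

open Finset in
-- The left side runs over all `b` modulo `p^{2m+2}`, while the interior weight at index `2` omits
-- the multiples of `p`; for these a factor `p` cancels from numerator and denominator.
lemma heckePart_two_zero {p : ℕ} {ψ : ℤ → ℂ} (hp : 0 < p) {F : ℂ → ℂ}
    (m : ℕ) (z : ℂ) :
    heckePart p ψ 1 2 (heckePart p ψ (m + 1) 0 F) z = heckePart p ψ (m + 2) 2 F z +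
      ∑ b ∈ range (p ^ (2 * m + 1)), F ((p * z + b) / p ^ (2 * m + 1)) := by
  have hp0 : (p : ℂ) ≠ 0 := by exact_mod_cast hp.ne'
  unfold heckePart
  simp only [heckeWeight_zero, heckeWeight_two (show 2 ≤ m + 2 by lia), one_mul, pow_zero]
  rw [show 2 * (m + 2) - 2 = 2 * m + 2 by lia, show 2 * (m + 1) - 0 = 2 * m + 2 by lia,
    show 2 * 1 - 2 = 0 by lia, pow_zero, sum_range_one]
  have h1 := sum_range_dvd (M := p ^ (2 * m + 1)) hp
    (fun b ↦ F (((p : ℂ) ^ 2 * z + b) / (p : ℂ) ^ (2 * m + 2)))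
  rw [← pow_succ'] at h1
  have h2 : ∑ b ∈ range (p ^ (2 * m + 1)), F ((p * z + b) / p ^ (2 * m + 1)) =
      ∑ b ∈ range (p ^ (2 * m + 1)),
        F (((p : ℂ) ^ 2 * z + ((p * b : ℤ) : ℂ)) / (p : ℂ) ^ (2 * m + 2)) := by
    refine sum_congr rfl fun b _ ↦ ?_
    congr 1
    push_cast
    rw [pow_succ (p : ℂ) (2 * m + 1)]
    field_simp
  rw [h2, ← h1, ← sum_add_distrib]
  have h3 : heckeWeight p ψ 1 2 ((0 : ℕ) : ℤ) = 1 := by simp [heckeWeight]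
  rw [h3, one_mul]
  refine sum_congr rfl fun b _ ↦ ?_
  split_ifs <;> simp

open Finset in
lemma heckePart_two_add_one {p : ℕ} {ψ : ℤ → ℂ} (hp : 0 < p) {F : ℂ → ℂ}
    (l t : ℕ) (z : ℂ) :
    heckePart p ψ 1 2 (heckePart p ψ l (t + 1) F) z = heckePart p ψ (l + 1) (t + 3) F z := by
  have hp0 : (p : ℂ) ≠ 0 := by exact_mod_cast hp.ne'
  unfold heckePart
  rw [show 2 * (l + 1) - (t + 3) = 2 * l - (t + 1) by lia, show 2 * 1 - 2 = 0 by lia, pow_zero,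
    sum_range_one]
  have h3 : heckeWeight p ψ 1 2 ((0 : ℕ) : ℤ) = 1 := by simp [heckeWeight]
  rw [h3, one_mul]
  refine sum_congr rfl fun b _ ↦ ?_
  rw [heckeWeight_add_two l (t + 1) (by lia)]
  congr 2
  push_cast
  ring

open Finset in
lemma heckePart_sum {p : ℕ} {ψ : ℤ → ℂ} (l i : ℕ) {ι : Type*} (s : Finset ι) (a : ι → ℂ)
    (F : ι → ℂ → ℂ) (z : ℂ) :
    heckePart p ψ l i (fun w ↦ ∑ x ∈ s, a x * F x w) z = ∑ x ∈ s, a x * heckePart p ψ l i (F x) z := by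
  unfold heckePart
  simp only [mul_sum]
  rw [sum_comm]
  exact sum_congr rfl fun x _ ↦ sum_congr rfl fun b _ ↦ by ring

open Finset in
/-- The Hecke recursion, for functions of period `1`. -/
theorem heckePoly_recursion {p : ℕ} {ψ : ℤ → ℂ} (hp : 0 < p) {F : ℂ → ℂ}
    (hF : ∀ w, F (w + 1) = F w) (hψ : ∀ b, ψ (b + p) = ψ b)
    (hψ0 : ∀ e : ℤ, ∑ h ∈ range p, ψ (e - h) = 0)
    (hψJ : ∀ e : ℤ, ∑ h ∈ range p, ψ h * ψ (e - h) = if (p : ℤ) ∣ e then (p : ℂ) - 1 else -1)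
    (X : ℂ) (m : ℕ) (hm : 1 ≤ m) (z : ℂ) :
    heckePoly p ψ X 1 (heckePoly p ψ X (m + 1) F) z =
      heckePoly p ψ X (m + 2) F z + X ^ 2 * (p : ℂ) ^ 2 * heckePoly p ψ X m F z := by
  have e : ∀ j, heckePart p ψ 1 j (heckePoly p ψ X (m + 1) F) z =
      ∑ i ∈ range (2 * (m + 1) + 1), X ^ i * heckePart p ψ 1 j (heckePart p ψ (m + 1) i F) z :=
    fun j ↦ heckePart_sum 1 j _ _ _ z
  rw [heckePoly, show 2 * 1 + 1 = 3 by rfl]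
  simp only [sum_range_succ _ 2, sum_range_succ _ 1, sum_range_one, e]
  -- The full level `m` sum is completed with coefficient `p²`; the term of index `2` has only `p² -
  -- p`, whence the negative correction, which the `p` in `B` compensates. The unweighted sums in
  -- `B` and `C` cancel because both acquire the factor `X²`.
  have A : ∑ i ∈ range (2 * (m + 1) + 1),
      X ^ i * heckePart p ψ 1 0 (heckePart p ψ (m + 1) i F) z =
      heckePart p ψ (m + 2) 0 F z - X ^ 2 * p * heckePart p ψ m 0 F z +
        X ^ 2 * (p : ℂ) ^ 2 * heckePoly p ψ X m F z := by
    rw [show 2 * (m + 1) + 1 = 2 * m + 1 + 1 + 1 by ring, sum_range_succ', sum_range_succ',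
      heckePart_zero_zero hp, zero_add, heckePart_zero_one hp hF hψ hψ0, heckePoly, sum_range_succ',
      sum_range_succ', mul_add, mul_sum]
    have : ∀ t ∈ range (2 * m), X ^ (t + 1 + 1 + 1) *
        heckePart p ψ 1 0 (heckePart p ψ (m + 1) (t + 1 + 1 + 1) F) z =
        X ^ 2 * (p : ℂ) ^ 2 * (X ^ (t + 1) * heckePart p ψ m (t + 1) F z) := by
      intro t ht
      rw [heckePart_zero_add_three hp hF hψ m t (by have := mem_range.mp ht; lia)]
      ring
    rw [sum_congr rfl this, heckePart_zero_two hp hF m hm]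
    ring
  have B : ∑ i ∈ range (2 * (m + 1) + 1),
      X ^ i * heckePart p ψ 1 1 (heckePart p ψ (m + 1) i F) z =
      heckePart p ψ (m + 2) 1 F z + X * (p * heckePart p ψ m 0 F z -
        ∑ b ∈ range (p ^ (2 * m + 1)), F ((p * z + b) / p ^ (2 * m + 1))) := by
    rw [show 2 * (m + 1) + 1 = 2 * m + 1 + 1 + 1 by ring, sum_range_succ', sum_range_succ',
      heckePart_one_zero hp hψ, zero_add, heckePart_one_one hp hF hψ hψJ, sum_eq_zero]
    · ring
    · intro t ht
      rw [heckePart_one_add_two hp hF hψ hψ0 m t (by have := mem_range.mp ht; lia), mul_zero]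
  have C : ∑ i ∈ range (2 * (m + 1) + 1),
      X ^ i * heckePart p ψ 1 2 (heckePart p ψ (m + 1) i F) z =
      heckePart p ψ (m + 2) 2 F z +
        ∑ b ∈ range (p ^ (2 * m + 1)), F ((p * z + b) / p ^ (2 * m + 1)) +
        ∑ t ∈ range (2 * (m + 1)), X ^ (t + 1) * heckePart p ψ (m + 2) (t + 3) F z := by
    rw [sum_range_succ', heckePart_two_zero hp]
    simp only [heckePart_two_add_one hp]
    ring
  have D : heckePoly p ψ X (m + 2) F z = heckePart p ψ (m + 2) 0 F z +
      X * heckePart p ψ (m + 2) 1 F z + X ^ 2 * heckePart p ψ (m + 2) 2 F z +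
      X ^ 2 * ∑ t ∈ range (2 * (m + 1)), X ^ (t + 1) * heckePart p ψ (m + 2) (t + 3) F z := by
    rw [heckePoly, show 2 * (m + 2) + 1 = 2 * (m + 1) + 1 + 1 + 1 by ring, sum_range_succ',
      sum_range_succ', sum_range_succ', mul_sum]
    have : ∀ t ∈ range (2 * (m + 1)), X ^ (t + 1 + 1 + 1) * heckePart p ψ (m + 2) (t + 1 + 1 + 1) F z =
        X ^ 2 * (X ^ (t + 1) * heckePart p ψ (m + 2) (t + 3) F z) := fun t _ ↦ by ring
    rw [sum_congr rfl this]
    ring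
  rw [A, B, C, D]
  ring

/-! ### The quadratic weight -/

/-- The weight `ε_pᵏ (-b / p)`. -/
def quadWeight (p k : ℕ) (b : ℤ) : ℂ := eps p ^ k * jacobiSym (-b) p

lemma quadWeight_add (p k : ℕ) (b : ℤ) : quadWeight p k (b + p) = quadWeight p k b := by
  unfold quadWeight
  rw [jacobiSym.mod_left' (a₁ := -(b + p)) (a₂ := -b)]
  exact Int.ModEq.symm (Int.modEq_iff_dvd.mpr ⟨-1, by ring⟩)

lemma quadWeight_eq (p k : ℕ) [Fact p.Prime] (b : ℤ) :
    quadWeight p k b = eps p ^ k * (quadraticChar (ZMod p) (-(b : ZMod p)) : ℤ) := by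
  rw [quadWeight, ← jacobiSym.legendreSym.to_jacobiSym, legendreSym]
  push_cast; rfl

lemma sum_range_eq_sum_zmod (p : ℕ) [NeZero p] (g : ZMod p → ℂ) :
    ∑ h ∈ Finset.range p, g (h : ZMod p) = ∑ x, g x :=
  Finset.sum_nbij' (fun h : ℕ ↦ (h : ZMod p)) ZMod.val (by simp)
    (fun x _ ↦ Finset.mem_range.mpr (ZMod.val_lt x))
    (fun h hh ↦ ZMod.val_cast_of_lt (Finset.mem_range.mp hh)) (by simp) (by simp)

lemma ringChar_zmod_ne_two {p : ℕ} (hp2 : p ≠ 2) : ringChar (ZMod p) ≠ 2 := by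
  rwa [ZMod.ringChar_zmod_n]

lemma sum_quadWeight (p k : ℕ) [Fact p.Prime] (hp2 : p ≠ 2) (e : ℤ) :
    ∑ h ∈ Finset.range p, quadWeight p k (e - h) = 0 := by
  simp only [quadWeight_eq]
  rw [← Finset.mul_sum]
  push_cast
  rw [sum_range_eq_sum_zmod p
    (fun x ↦ ((quadraticChar (ZMod p) (-((e : ZMod p) - x)) : ℤ) : ℂ))]
  rw [← Equiv.sum_comp (Equiv.addRight (e : ZMod p))]
  have h := quadraticChar_sum_zero (F := ZMod p) (ringChar_zmod_ne_two hp2)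
  have h' : (∑ x : ZMod p, ((quadraticChar (ZMod p) x : ℤ) : ℂ)) = 0 := by exact_mod_cast h
  have hx : ∀ x : ZMod p, -((e : ZMod p) - Equiv.addRight (e : ZMod p) x) = x := by simp
  simp only [hx]
  rw [h', mul_zero]

lemma eps_sq (p : ℕ) [Fact p.Prime] (hp2 : p ≠ 2) :
    eps p ^ 2 = (quadraticChar (ZMod p) (-1) : ℤ) := by
  rw [quadraticChar_neg_one (ringChar_zmod_ne_two hp2), ZMod.card]
  have hodd := (Fact.out : p.Prime).eq_two_or_odd.resolve_left hp2
  rcases (show p % 4 = 1 ∨ p % 4 = 3 by lia) with h | h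
  · rw [ZMod.χ₄_nat_one_mod_four h, eps, if_pos (by lia)]; simp
  · rw [ZMod.χ₄_nat_three_mod_four h, eps, if_neg (by lia)]; simp

/-- For `e ≠ 0` the substitution `x ↦ e x` gives the Jacobi sum of the quadratic character with
itself, that is with its inverse, which equals `-χ(-1)`. For `e = 0` each nonzero term is `χ(-1)`.
-/
lemma sum_quadraticChar_mul (p : ℕ) [Fact p.Prime] (hp2 : p ≠ 2) (e : ZMod p) :
    ∑ x, quadraticChar (ZMod p) x * quadraticChar (ZMod p) (e - x) =
      quadraticChar (ZMod p) (-1) * if e = 0 then (p : ℤ) - 1 else -1 := by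
  set χ := quadraticChar (ZMod p) with hχ
  split_ifs with he
  · have h1 : ∀ x : ZMod p, χ x * χ (e - x) = χ (-1) * if x = 0 then 0 else 1 := by
      intro x
      rw [he, zero_sub, neg_eq_neg_one_mul, map_mul]
      split_ifs with hx
      · rw [hx, MulChar.map_zero]; ring
      · linear_combination χ (-1) * quadraticChar_sq_one hx
    simp only [h1]
    rw [← Finset.mul_sum]
    congr 1
    have h2 : ∀ x : ZMod p, (if x = 0 then (0 : ℤ) else 1) = 1 - if x = 0 then 1 else 0 := by
      intro x; split_ifs <;> simp
    simp [h2, ZMod.card]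
  · have hJ := jacobiSum_nontrivial_inv (quadraticChar_ne_one (ringChar_zmod_ne_two hp2))
    rw [(quadraticChar_isQuadratic (ZMod p)).inv, jacobiSum] at hJ
    rw [← Equiv.sum_comp (Equiv.mulLeft₀ e he)]
    have h1 : ∀ x : ZMod p, χ (Equiv.mulLeft₀ e he x) * χ (e - Equiv.mulLeft₀ e he x) =
        χ x * χ (1 - x) := by
      intro x
      have : e - e * x = e * (1 - x) := by ring
      change χ (e * x) * χ (e - e * x) = _
      rw [this, map_mul, map_mul]
      linear_combination χ x * χ (1 - x) * quadraticChar_sq_one he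
    simp only [h1]
    rw [hJ]
    ring

lemma sum_quadWeight_mul (p k : ℕ) [Fact p.Prime] (hp2 : p ≠ 2) (hk : Odd k) (e : ℤ) :
    ∑ h ∈ Finset.range p, quadWeight p k h * quadWeight p k (e - h) =
      if (p : ℤ) ∣ e then (p : ℂ) - 1 else -1 := by
  have hneg : (quadraticChar (ZMod p) (-1)) ^ 2 = 1 := quadraticChar_sq_one (by simp)
  -- Since `ε_p² = (-1/p)` and `k` is odd, `ε_p^{2k} = (-1/p)`, which cancels the factor `χ(-1)` of
  -- the Jacobi sum.
  have hε : eps p ^ k * eps p ^ k = (quadraticChar (ZMod p) (-1) : ℤ) := by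
    rw [← pow_add, ← two_mul, pow_mul, eps_sq p hp2]
    obtain ⟨a, rfl⟩ := hk
    rw [pow_add, pow_mul]
    have : (((quadraticChar (ZMod p) (-1) : ℤ)) : ℂ) ^ 2 = 1 := by exact_mod_cast hneg
    rw [this]; simp
  have h1 : ∀ h : ℕ, quadWeight p k h * quadWeight p k (e - h) =
      ((quadraticChar (ZMod p) (-1) * (quadraticChar (ZMod p) (h : ZMod p) *
        quadraticChar (ZMod p) ((e : ZMod p) - h)) : ℤ) : ℂ) := by
    intro h
    rw [quadWeight_eq, quadWeight_eq, mul_mul_mul_comm, hε]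
    push_cast
    rw [neg_eq_neg_one_mul (h : ZMod p), neg_eq_neg_one_mul ((e : ZMod p) - h), map_mul, map_mul]
    have : (((quadraticChar (ZMod p) (-1) : ℤ)) : ℂ) ^ 2 = 1 := by exact_mod_cast hneg
    push_cast
    linear_combination (quadraticChar (ZMod p) (-1) : ℂ) * (quadraticChar (ZMod p) (h : ZMod p)) *
      (quadraticChar (ZMod p) ((e : ZMod p) - h)) * this
  simp only [h1]
  rw [sum_range_eq_sum_zmod p (fun x ↦ ((quadraticChar (ZMod p) (-1) *
    (quadraticChar (ZMod p) x * quadraticChar (ZMod p) ((e : ZMod p) - x)) : ℤ) : ℂ)),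
    ← Int.cast_sum, ← Finset.mul_sum, sum_quadraticChar_mul p hp2, ← mul_assoc, ← sq, hneg, one_mul]
  simp only [ZMod.intCast_zmod_eq_zero_iff_dvd]
  split_ifs <;> simp

/-! ### The Hecke operators as sums of translates -/

lemma sqrt_natCast_pow (p l : ℕ) :
    ((Real.sqrt (p ^ l : ℕ) : ℝ) : ℂ) = ((Real.sqrt p : ℝ) : ℂ) ^ l := by
  induction l with
  | zero => simp
  | succ l ih =>
    rw [pow_succ, pow_succ, ← ih, Nat.cast_mul, Real.sqrt_mul (Nat.cast_nonneg _)]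
    push_cast; ring

/-- The `n^{k/2}` of the normalization cancels the `k`-th power of the component `n^{1/2}` of `ξ`,
and `n^{-2} = p^{-2l}` remains in front of the sum. -/
lemma hecke_normalization (k p l : ℕ) (hp : 0 < p) :
    ((((p ^ l : ℕ) : ℝ) ^ ((k : ℝ) / 2 - 2) : ℝ) : ℂ) =
      (((Real.sqrt p : ℝ) : ℂ) ^ l) ^ k * ((p : ℂ) ^ (2 * l))⁻¹ := by
  have h0 : (0 : ℝ) < (p ^ l : ℕ) := by exact_mod_cast pow_pos hp l
  have h1 : ((p ^ l : ℕ) : ℝ) ^ ((k : ℝ) / 2) = Real.sqrt (p ^ l : ℕ) ^ k := by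
    rw [Real.sqrt_eq_rpow, ← Real.rpow_natCast, ← Real.rpow_mul h0.le]
    congr 1; ring
  rw [Real.rpow_sub h0, h1, ← sqrt_natCast_pow, div_eq_mul_inv]
  push_cast
  rw [mul_comm 2 l, pow_mul]
  congr 2
  exact_mod_cast Real.rpow_natCast ((p : ℝ) ^ l) 2

lemma inv_eps_pow_mul {k : ℕ} (hk : Odd k) {J : ℤ} (hJ : J = 1 ∨ J = -1) (d : ℤ) (r : ℂ) :
    ((r * J * (eps d)⁻¹) ^ k)⁻¹ = (r ^ k)⁻¹ * (eps d ^ k * J) := by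
  have h : ((J : ℂ) ^ k)⁻¹ = J := by
    rcases hJ with rfl | rfl
    · simp
    · simp [hk.neg_one_pow]
  rw [mul_pow, mul_pow, mul_inv, mul_inv, inv_pow, inv_inv, h]
  ring

/-- As `p² ≡ 1` modulo `4` and `(-b/p)² = 1` for `p ∤ b`, both `ε` and the symbol depend only on the
parity of `i`. -/
lemma eps_pow_mul_eq_heckeWeight {p k : ℕ} (hp : p.Prime) (hp2 : p ≠ 2) {l i b : ℕ}
    (hcop : Nat.Coprime b (p ^ i)) :
    eps (p ^ i : ℕ) ^ k * (jacobiSym (-b) (p ^ i) : ℂ) =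
      heckeWeight p (quadWeight p k) l i b := by
  have hp4 : p % 4 = 1 ∨ p % 4 = 3 := by
    have := hp.eq_two_or_odd.resolve_left hp2; lia
  have hsq : p ^ 2 ≡ 1 [MOD 4] := by
    have := Nat.pow_mod p 2 4
    rcases hp4 with h | h <;> rw [h] at this <;> exact this
  rcases Nat.even_or_odd' i with ⟨t, rfl | rfl⟩
  · have hmod : p ^ (2 * t) % 4 = 1 := by
      have := hsq.pow t
      rw [← pow_mul, one_pow] at this
      exact this
    have hone : eps (p ^ (2 * t) : ℕ) = 1 := by
      rw [eps, if_pos (by lia)]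
    rw [hone, one_pow, one_mul, jacobiSym.pow_right, pow_mul]
    rcases Nat.eq_zero_or_pos t with h | h
    · simp [heckeWeight, h]
    · have hc : Nat.Coprime b p := Nat.Coprime.coprime_dvd_right (dvd_pow_self p (by lia)) hcop
      have hJ : jacobiSym (-b) p ^ 2 = 1 := by
        refine jacobiSym.sq_one ?_
        rw [Int.neg_gcd, Int.gcd_natCast_natCast]; exact hc
      have hnd : ¬ (p : ℤ) ∣ b := by
        rw [Int.natCast_dvd_natCast]
        exact (hp.coprime_iff_not_dvd).mp hc.symm
      have hw : heckeWeight p (quadWeight p k) l (2 * t) b = 1 := by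
        unfold heckeWeight
        split_ifs <;> first | rfl | (exfalso; grind)
      rw [hJ, hw]; simp
  · have hmod : p ^ (2 * t + 1) % 4 = p % 4 := by
      have := (hsq.pow t).mul_right p
      rw [← pow_mul, one_pow, one_mul, ← pow_succ] at this
      exact this
    have hone : eps (p ^ (2 * t + 1) : ℕ) = eps p := by
      unfold eps
      congr 1
      simp only [eq_iff_iff]; lia
    have hJ : jacobiSym (-b) (p ^ (2 * t + 1)) = jacobiSym (-b) p := by
      have hc : Nat.Coprime b p := Nat.Coprime.coprime_dvd_right (dvd_pow_self p (by lia)) hcop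
      have hJ : jacobiSym (-b) p ^ 2 = 1 := by
        refine jacobiSym.sq_one ?_
        rw [Int.neg_gcd, Int.gcd_natCast_natCast]; exact hc
      rw [jacobiSym.pow_right, pow_succ, pow_mul, hJ, one_pow, one_mul]
    rw [hone, hJ, heckeWeight, if_neg (by lia), if_pos ⟨t, rfl⟩, quadWeight]

/-- On `ℍ` this is invariance under `T`, where `j = 1`. Elsewhere `ofComplex` has a constant value,
so the period holds on all of `ℂ`. -/
lemma periodic_ofComplex {k N : ℕ} {χ : DirichletCharacter ℂ N} (f : modForms k N χ) (w : ℂ) :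
    f.1 (ofComplex (w + 1)) = f.1 (ofComplex w) := by
  by_cases hw : 0 < w.im
  · have hw' : 0 < (w + 1).im := by simpa using hw
    have hT : ModularGroup.T ∈ CongruenceSubgroup.Gamma0 N :=
      mem_gamma0_of_dvd (by simp [ModularGroup.T])
    have h := f.2.2.1 _ hT (ofComplex w)
    have h1 : autFactor ModularGroup.T (ofComplex w) = 1 := by
      simp [autFactor, quadSymbol, eps, ModularGroup.T]
    have h2 : ModularGroup.T • ofComplex w = ofComplex (w + 1) := by
      ext1
      have := ModularGroup.coe_T_zpow_smul_eq (n := 1) (z := ofComplex w)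
      rw [zpow_one] at this
      rw [this, ofComplex_apply_of_im_pos hw, ofComplex_apply_of_im_pos hw']
      simp
    rw [h1, h2] at h
    simpa [ModularGroup.T] using h
  · rw [ofComplex_apply_of_im_nonpos (not_lt.mp hw),
      ofComplex_apply_of_im_nonpos (by simpa using hw)]

lemma sum_Icc_eq_sum_range {M : ℕ} {g : ℤ → ℂ} (hg : ∀ b, g (b + M) = g b) :
    ∑ b ∈ Finset.Icc 1 M, g b = ∑ b ∈ Finset.range M, g b := by
  rw [← sum_range_shift hg 1, ← Finset.Ico_succ_right_eq_Icc, Finset.sum_Ico_eq_sum_range]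
  refine Finset.sum_congr (by simp) fun b _ ↦ ?_
  push_cast; rw [add_comm]

/-- `T_{p²ˡ}` for `p ∤ N`, as a sum of translates. -/
theorem heckeTSq_apply_of_not_dvd {k N p l n : ℕ} [NeZero n] {χ : DirichletCharacter ℂ N}
    (hk : Odd k) (hN : 0 < N) (h4 : 4 ∣ N) (hp : p.Prime) (hpN : ¬ p ∣ N) (hn : n = p ^ l)
    (f : modForms k N χ) (z : ℍ) :
    (heckeTSq k χ n f).1 z = ((p : ℂ) ^ (2 * l))⁻¹ *
      heckePoly p (quadWeight p k) (χ (p : ZMod N) * ((Real.sqrt p : ℝ) : ℂ) ^ k) l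
        (fun w ↦ f.1 (ofComplex w)) z := by
  subst hn
  have : NeZero p := ⟨hp.ne_zero⟩
  have hp2 : p ≠ 2 := by
    rintro rfl; exact hpN ((show 2 ∣ 4 by norm_num).trans h4)
  have hs : ((Real.sqrt p : ℝ) : ℂ) ≠ 0 := by
    have : 0 < Real.sqrt p := Real.sqrt_pos.mpr (by exact_mod_cast hp.pos)
    exact_mod_cast this.ne'
  change ((((p ^ l : ℕ) : ℝ) ^ ((k : ℝ) / 2 - 2) : ℝ) : ℂ) * cosetSum (p ^ l) f z = _
  rw [cosetSum_apply hN h4 hp, hecke_normalization k p l hp.pos, cosetIndex, Finset.sum_sigma]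
  rw [mul_comm (_ ^ k), mul_assoc]
  congr 1
  rw [heckePoly, Finset.mul_sum]
  refine Finset.sum_congr rfl fun i hi ↦ ?_
  have hi' : i ≤ 2 * l := Nat.lt_succ_iff.mp (Finset.mem_range.mp hi)
  set g : ℤ → ℂ := fun b ↦ heckeWeight p (quadWeight p k) l i b *
    f.1 (ofComplex (((p : ℂ) ^ i * z + b) / (p : ℂ) ^ (2 * l - i))) with hg
  have hgper : ∀ b, g (b + (p ^ (2 * l - i) : ℕ)) = g b := by
    intro b
    have h1 := periodic_div (F := fun w ↦ f.1 (ofComplex w)) (periodic_ofComplex f) (pow_ne_zero (2 * l - i) hp.ne_zero)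
      ((p : ℂ) ^ i * z) b
    have h2 : heckeWeight p (quadWeight p k) l i (b + (p ^ (2 * l - i) : ℕ)) =
        heckeWeight p (quadWeight p k) l i b := by
      rcases hi'.eq_or_lt with h | h
      · simp [heckeWeight, h]
      · exact periodic_of_dvd (dvd_pow_self p (by lia))
          (heckeWeight_add (quadWeight_add p k) l i) b
    simp only [hg]
    rw [h2]
    push_cast at h1 ⊢
    rw [h1]
  have hpart : heckePart p (quadWeight p k) l i (fun w ↦ f.1 (ofComplex w)) z =
      ∑ b ∈ Finset.Icc 1 (p ^ (2 * l - i)), g b := by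
    rw [sum_Icc_eq_sum_range hgper, heckePart]
    simp [hg]
  rw [hpart, Finset.sum_filter, Finset.mul_sum, Finset.mul_sum]
  refine Finset.sum_congr rfl fun b hb ↦ ?_
  obtain ⟨hb1, hb2⟩ := Finset.mem_Icc.mp hb
  split_ifs with hcop
  · have hcop' : Nat.Coprime b (p ^ i) := Nat.Coprime.coprime_dvd_left (Dvd.intro_left _ rfl) hcop
    have hJ : jacobiSym (-b) (p ^ i) = 1 ∨ jacobiSym (-b) (p ^ i) = -1 := by
      refine jacobiSym.eq_one_or_neg_one ?_
      rw [Int.neg_gcd, Int.gcd_natCast_natCast]; exact hcop'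
    rw [inv_eps_pow_mul hk hJ, eps_pow_mul_eq_heckeWeight (l := l) hp hp2 hcop', sqrt_natCast_pow,
      sqrt_natCast_pow]
    simp only [hg]
    push_cast
    rw [map_pow, div_pow, inv_div, mul_pow, pow_right_comm _ k i]
    field_simp
  -- The `b` excluded by coprimality are those divisible by `p` with `i > 0`, and their weight
  -- vanishes. At `i = 2 * l` the only index in the interval is `b = 1`, so nothing is excluded
  -- there.
  · have h0 : heckeWeight p (quadWeight p k) l i b = 0 := by
      have hi0 : i ≠ 0 := by
        rintro rfl; exact hcop (by rw [pow_zero]; exact Nat.coprime_one_right _)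
      have hpb : p ∣ b := by
        by_contra hpb
        refine hcop (Nat.Coprime.pow_right _ (Nat.coprime_comm.mp ?_))
        rw [hp.coprime_iff_not_dvd, hp.dvd_mul]
        tauto
      have hi2 : i ≠ 2 * l := by
        rintro rfl
        rw [Nat.sub_self, pow_zero] at hb2
        exact hp.one_lt.not_ge ((Nat.le_of_dvd hb1 hpb).trans hb2)
      have hpb' : (p : ℤ) ∣ b := by exact_mod_cast hpb
      have : Fact p.Prime := ⟨hp⟩
      unfold heckeWeight
      rw [if_neg (by tauto), if_pos hpb']
      split_ifs
      · rw [quadWeight_eq, Int.cast_natCast, (ZMod.natCast_eq_zero_iff b p).mpr hpb]; simp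
      · rfl
    simp [hg, h0]

/-- `T_{p²ˡ}` for `p ∣ N`, as a sum of translates. -/
theorem heckeTSq_apply_of_dvd {k N p l n : ℕ} [NeZero n] {χ : DirichletCharacter ℂ N}
    (hN : 0 < N) (h4 : 4 ∣ N) (hp : p.Prime) (hpN : p ∣ N) (hn : n = p ^ l)
    (f : modForms k N χ) (z : ℍ) :
    (heckeTSq k χ n f).1 z = ((p : ℂ) ^ (2 * l))⁻¹ *
      heckePart p 0 l 0 (fun w ↦ f.1 (ofComplex w)) z := by
  subst hn
  have : NeZero p := ⟨hp.ne_zero⟩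
  have hs : ((Real.sqrt p : ℝ) : ℂ) ≠ 0 := by
    have : 0 < Real.sqrt p := Real.sqrt_pos.mpr (by exact_mod_cast hp.pos)
    exact_mod_cast this.ne'
  change ((((p ^ l : ℕ) : ℝ) ^ ((k : ℝ) / 2 - 2) : ℝ) : ℂ) * cosetSum (p ^ l) f z = _
  rw [cosetSum_apply hN h4 hp, hecke_normalization k p l hp.pos, cosetIndex, Finset.sum_sigma,
    Finset.sum_eq_single_of_mem 0 (by simp)]
  · set g : ℤ → ℂ := fun b ↦
      f.1 (ofComplex (((p : ℂ) ^ 0 * z + b) / (p : ℂ) ^ (2 * l - 0))) with hg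
    have hgper : ∀ b, g (b + (p ^ (2 * l - 0) : ℕ)) = g b := by
      intro b
      have h1 := periodic_div (F := fun w ↦ f.1 (ofComplex w)) (periodic_ofComplex f) (pow_ne_zero (2 * l - 0) hp.ne_zero)
        ((p : ℂ) ^ 0 * z) b
      simp only [hg]
      push_cast at h1 ⊢
      rw [h1]
    have hpart : heckePart p 0 l 0 (fun w ↦ f.1 (ofComplex w)) z =
        ∑ b ∈ Finset.Icc 1 (p ^ (2 * l - 0)), g b := by
      rw [sum_Icc_eq_sum_range hgper, heckePart]
      simp [hg, heckeWeight_zero]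
    rw [hpart, mul_comm (_ ^ k), mul_assoc]
    congr 1
    rw [Finset.sum_filter, Finset.mul_sum]
    refine Finset.sum_congr rfl fun b hb ↦ ?_
    rw [if_pos (by simp), sqrt_natCast_pow]
    simp only [hg]
    simp [eps]
    field_simp
  -- For `i > 0`, `p` divides both `N b` and `p^i`, so no `b` is admissible.
  · intro i _ hi
    rw [Finset.filter_false_of_mem, Finset.sum_empty]
    intro b _ hcop
    have h1 : p ∣ N * b := hpN.mul_right b
    exact hp.not_isUnit (Nat.isUnit_iff.mpr
      (Nat.eq_one_of_dvd_coprimes hcop h1 (dvd_pow_self p hi)))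

/-! ### The relations between the Hecke operators. -/

/-- The formula for `T_{p^{2l}} f` is known only on `ℍ`; the maps `z ↦ (p^i z + b)/p^{2l-i}`
preserve `ℍ`, so it may be substituted inside another sum. -/
lemma heckePart_congr {p : ℕ} (hp : 0 < p) {ψ : ℤ → ℂ} {l i : ℕ} {F G : ℂ → ℂ}
    (h : ∀ w : ℂ, 0 < w.im → F w = G w) {z : ℂ} (hz : 0 < z.im) :
    heckePart p ψ l i F z = heckePart p ψ l i G z := by
  refine Finset.sum_congr rfl fun b _ ↦ ?_
  rw [h]
  have h1 : ((p : ℂ) ^ i * z + b) / (p : ℂ) ^ (2 * l - i) =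
      (((p : ℝ) ^ i / (p : ℝ) ^ (2 * l - i) : ℝ) : ℂ) * z +
        (((b : ℝ) / (p : ℝ) ^ (2 * l - i) : ℝ) : ℂ) := by
    push_cast; ring
  rw [h1, Complex.add_im, Complex.ofReal_im, Complex.im_ofReal_mul, add_zero]
  have : (0 : ℝ) < p := by exact_mod_cast hp
  positivity

lemma heckePart_const_mul {p : ℕ} {ψ : ℤ → ℂ} {l i : ℕ} (a : ℂ) (F : ℂ → ℂ) (z : ℂ) :
    heckePart p ψ l i (fun w ↦ a * F w) z = a * heckePart p ψ l i F z := by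
  rw [heckePart, heckePart, Finset.mul_sum]
  exact Finset.sum_congr rfl fun b _ ↦ by ring

lemma heckePoly_congr {p : ℕ} (hp : 0 < p) {ψ : ℤ → ℂ} {X : ℂ} {l : ℕ} {F G : ℂ → ℂ}
    (h : ∀ w : ℂ, 0 < w.im → F w = G w) {z : ℂ} (hz : 0 < z.im) :
    heckePoly p ψ X l F z = heckePoly p ψ X l G z :=
  Finset.sum_congr rfl fun i _ ↦ by rw [heckePart_congr hp h hz]

lemma heckePoly_const_mul {p : ℕ} {ψ : ℤ → ℂ} {X : ℂ} {l : ℕ} (a : ℂ) (F : ℂ → ℂ) (z : ℂ) :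
    heckePoly p ψ X l (fun w ↦ a * F w) z = a * heckePoly p ψ X l F z := by
  rw [heckePoly, heckePoly, Finset.mul_sum]
  exact Finset.sum_congr rfl fun i _ ↦ by rw [heckePart_const_mul]; ring

theorem heckeTSq_succ_of_dvd {k N p l : ℕ} [NeZero p] {χ : DirichletCharacter ℂ N}
    (hN : 0 < N) (h4 : 4 ∣ N) (hp : p.Prime) (hpN : p ∣ N) :
    heckeTSq k χ (p ^ (l + 1)) = heckeTSq k χ p * heckeTSq k χ (p ^ l) := by
  refine LinearMap.ext fun f ↦ Subtype.ext (funext fun z ↦ ?_)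
  have hcomp : heckePart p 0 1 0 (fun w ↦ (heckeTSq k χ (p ^ l) f).1 (ofComplex w)) z =
      ((p : ℂ) ^ (2 * l))⁻¹ * heckePart p 0 (l + 1) 0 (fun w ↦ f.1 (ofComplex w)) z := by
    rw [← heckePart_zero_zero hp.pos (ψ := 0) l z, ← heckePart_const_mul]
    refine heckePart_congr hp.pos (fun w hw ↦ ?_) z.im_pos
    rw [heckeTSq_apply_of_dvd hN h4 hp hpN rfl, ofComplex_apply_of_im_pos hw]
  rw [Module.End.mul_apply, heckeTSq_apply_of_dvd hN h4 hp hpN rfl,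
    heckeTSq_apply_of_dvd hN h4 hp hpN (pow_one p).symm, hcomp, ← mul_assoc, ← mul_inv, ← pow_add]
  congr 3; ring

theorem heckeTSq_succ_of_not_dvd {k N p m : ℕ} [NeZero p] {χ : DirichletCharacter ℂ N}
    (hk : Odd k) (hN : 0 < N) (h4 : 4 ∣ N) (hp : p.Prime) (hpN : ¬ p ∣ N) (hm : 1 ≤ m) :
    heckeTSq k χ (p ^ (m + 2)) = heckeTSq k χ p * heckeTSq k χ (p ^ (m + 1)) -
      (χ ((p ^ 2 : ℕ) : ZMod N) * (p : ℂ) ^ ((k : ℤ) - 2)) • heckeTSq k χ (p ^ m) := by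
  refine LinearMap.ext fun f ↦ Subtype.ext (funext fun z ↦ ?_)
  have : Fact p.Prime := ⟨hp⟩
  have hp2 : p ≠ 2 := by
    rintro rfl; exact hpN ((show 2 ∣ 4 by norm_num).trans h4)
  have hp0 : (p : ℂ) ≠ 0 := by exact_mod_cast hp.ne_zero
  change _ = (heckeTSq k χ p (heckeTSq k χ (p ^ (m + 1)) f)).1 z -
    (χ ((p ^ 2 : ℕ) : ZMod N) * (p : ℂ) ^ ((k : ℤ) - 2)) * (heckeTSq k χ (p ^ m) f).1 z
  set X : ℂ := χ (p : ZMod N) * ((Real.sqrt p : ℝ) : ℂ) ^ k with hX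
  have hcomp : heckePoly p (quadWeight p k) X 1
      (fun w ↦ (heckeTSq k χ (p ^ (m + 1)) f).1 (ofComplex w)) z =
      ((p : ℂ) ^ (2 * (m + 1)))⁻¹ *
        (heckePoly p (quadWeight p k) X (m + 2) (fun w ↦ f.1 (ofComplex w)) z +
          X ^ 2 * (p : ℂ) ^ 2 * heckePoly p (quadWeight p k) X m (fun w ↦ f.1 (ofComplex w)) z) := by
    rw [← heckePoly_recursion hp.pos (periodic_ofComplex f) (quadWeight_add p k)
      (sum_quadWeight p k hp2) (sum_quadWeight_mul p k hp2 hk) X m hm, ← heckePoly_const_mul]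
    refine heckePoly_congr hp.pos (fun w hw ↦ ?_) z.im_pos
    rw [heckeTSq_apply_of_not_dvd hk hN h4 hp hpN rfl, ofComplex_apply_of_im_pos hw]
  rw [heckeTSq_apply_of_not_dvd hk hN h4 hp hpN rfl,
    heckeTSq_apply_of_not_dvd hk hN h4 hp hpN rfl,
    heckeTSq_apply_of_not_dvd hk hN h4 hp hpN (pow_one p).symm, ← hX, hcomp]
  have hX2 : X ^ 2 = χ ((p ^ 2 : ℕ) : ZMod N) * (p : ℂ) ^ k := by
    have hs : (((Real.sqrt p : ℝ) : ℂ)) ^ 2 = p := by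
      rw [← Complex.ofReal_pow, Real.sq_sqrt (Nat.cast_nonneg p)]; simp
    rw [hX, mul_pow, ← pow_mul, mul_comm k 2, pow_mul, hs]
    push_cast
    rw [map_pow]
  -- With `X² = χ(p²) p^k`, the coefficient `X² p²` divided by `p^{2m+4}` is `χ(p²) p^{k-2}` times
  -- the normalization `p^{-2m}` of level `m`. The exponent `k - 2` is an integer power, being
  -- negative for `k = 1`.
  rw [hX2, zpow_sub₀ hp0, zpow_natCast]
  have e1 : (p : ℂ) ^ (2 * (m + 2)) = p ^ (2 * m) * p ^ 4 := by ring
  have e2 : (p : ℂ) ^ (2 * (m + 1)) = p ^ (2 * m) * p ^ 2 := by ring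
  rw [e1, e2]
  field_simp
  ring

theorem heckeTSq_pow_of_dvd {k N p : ℕ} [NeZero p] {χ : DirichletCharacter ℂ N}
    (hN : 0 < N) (h4 : 4 ∣ N) (hp : p.Prime) (hpN : p ∣ N) {l : ℕ} (hl : 1 ≤ l) :
    heckeTSq k χ (p ^ l) = heckeTSq k χ p ^ l := by
  induction l, hl using Nat.le_induction with
  | base =>
    refine (LinearMap.ext fun f ↦ Subtype.ext (funext fun z ↦ ?_)).trans (pow_one _).symm
    rw [heckeTSq_apply_of_dvd hN h4 hp hpN rfl, heckeTSq_apply_of_dvd hN h4 hp hpN (pow_one p).symm]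
  | succ l _ ih => rw [heckeTSq_succ_of_dvd hN h4 hp hpN, ih, pow_succ']

end HalfIntegral

end

theorem theorem1 (k N : ℕ) (hk : Odd k) (hN : 0 < N) (h4 : 4 ∣ N) (χ : DirichletCharacter ℂ N)
    (p : ℕ) [NeZero p] (hp : p.Prime) (ℓ : ℕ) (hℓ : 2 ≤ ℓ) :
    (p ∣ N → HalfIntegral.heckeTSq k χ (p ^ ℓ) = HalfIntegral.heckeTSq k χ p ^ ℓ) ∧
    (¬ p ∣ N → HalfIntegral.heckeTSq k χ (p ^ (ℓ + 1)) =
      HalfIntegral.heckeTSq k χ p * HalfIntegral.heckeTSq k χ (p ^ ℓ) -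
        (χ ((p ^ 2 : ℕ) : ZMod N) * (p : ℂ) ^ ((k : ℤ) - 2)) •
          HalfIntegral.heckeTSq k χ (p ^ (ℓ - 1))) := by
  refine ⟨fun hpN ↦ HalfIntegral.heckeTSq_pow_of_dvd hN h4 hp hpN (by lia), fun hpN ↦ ?_⟩
  -- The assumption `ℓ ≥ 2` means `m ≥ 1`. For `m = 0` the coefficient `p²` in the recursion would
  -- become `p² + p`, by the exception in `heckePart_zero_two`.
  obtain ⟨m, rfl⟩ : ∃ m, ℓ = m + 1 := ⟨ℓ - 1, by lia⟩
  exact HalfIntegral.heckeTSq_succ_of_not_dvd hk hN h4 hp hpN (by lia)
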